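/- Let $b\ge 2$ be an integer. For $x\in[0,1)$ let $x=\sum_{i\ge1}x_i b^{-i}$, $x_i\in\{0,\dots,b-1\}$, be its base-$b$ expansion (for the countably many $x$ with two expansions, the one with $x_i\ne b-1$ for infinitely many $i$). For a word $w\in\{0,\dots,b-1\}^k$ and $n\ge0$, let $N_x(w,n)$ be the number of (possibly overlapping) occurrences of $w$ in $x_1x_2\cdots x_n$. For real $\lambda>0$ and integers $j,k\ge 0$ let $$Z^\lambda_{j,k}(x)=\frac1{b^k}\,\Bigl|\bigl\{w\in\{0,\dots,b-1\}^k : N_x\bigl(w,\lfloor\lambda b^k+k\rfloor\bigr)=j\bigr\}\Bigr|.$$ The number $x$ is - normal in base $b$ if $\lim_{n\to\infty}N_x(w,n)/n=b^{-k}$ for every $k\ge 0$ and every word $w$ of length $k$; - Poisson generic in base $b$ if $\lim_{k\to\infty}Z^\lambda_{j,k}(x)=e^{-\lambda}\lambda^j/j!$ for every real $\lambda>0$ and every integer $j\ge0$; - weakly Poisson generic in base $b$ if for every $\epsilon>0$, every rational $\lambda>0$ and every integer $j\ge0$, one has $\bigl|Z^\lambda_{j,k}(x)-e^{-\lambda}\lambda^j/j!\bigr|<\epsilon$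 for infinitely many $k$. Then for every integer $b\ge2$ there is $x\in[0,1)$ that is normal in base $b$ and weakly Poisson generic in base $b$, but not Poisson generic in base $b$. -/

import Mathlib

open Filter Topology

namespace PoissonGeneric

/-- Number of (possibly overlapping) occurrences of the word `w` of length `k` in the initial
segment `d 0, …, d (n - 1)` of length `n` of the sequence `d`. -/
def occ {b k : ℕ} (d : ℕ → Fin b) (w : Fin k → Fin b) (n : ℕ) : ℕ :=
  ((Finset.range (n + 1)).filter (fun i => i + k ≤ n ∧ ∀ m : Fin k, d (i + m) = w m)).card

/-- `Z b x l j k` is the proportion of words of length `k` over `{0, …, b - 1}` which occur exactly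
`j` times among the first `⌊l b ^ k + k⌋` base-`b` digits of `x`. (`Real.digits x b i` is the
digit of `b ^ (-(i + 1))` in the base-`b` expansion of `x ∈ [0, 1)`.) -/
noncomputable def Z (b : ℕ) [NeZero b] (x l : ℝ) (j k : ℕ) : ℝ :=
  ((Finset.univ.filter
    (fun w : Fin k → Fin b => occ (Real.digits x b) w ⌊l * (b : ℝ) ^ k + k⌋₊ = j)).card : ℝ)
    / (b : ℝ) ^ k

/-- The weight that the Poisson distribution with parameter `l` gives to `j`. -/
noncomputable def poissonWeight (l : ℝ) (j : ℕ) : ℝ :=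
  Real.exp (-l) * l ^ j / (j.factorial : ℝ)

/-- Poisson genericity of `x` in base `b`: `l`-Poisson genericity for all real `l > 0`. -/
def IsPoissonGeneric (b : ℕ) [NeZero b] (x : ℝ) : Prop :=
  ∀ l : ℝ, 0 < l → ∀ j : ℕ, Tendsto (fun k => Z b x l j k) atTop (𝓝 (poissonWeight l j))

/-- Weak Poisson genericity of `x` in base `b`. -/
def IsWeaklyPoissonGeneric (b : ℕ) [NeZero b] (x : ℝ) : Prop :=
  ∀ ε : ℝ, 0 < ε → ∀ q : ℚ, 0 < q → ∀ j : ℕ,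
    {k : ℕ | |Z b x q j k - poissonWeight q j| < ε}.Infinite

/-- Borel normality of `x` in base `b`. -/
def IsNormal (b : ℕ) [NeZero b] (x : ℝ) : Prop :=
  ∀ (k : ℕ) (w : Fin k → Fin b),
    Tendsto (fun n : ℕ => (occ (Real.digits x b) w n : ℝ) / n) atTop (𝓝 (((b : ℝ) ^ k)⁻¹))

end PoissonGeneric

/-! The sequence is built in stages. A prefix of length `N`, with `k ^ 4 ≤ N ≤ (k + 1) ^ 4`, is
extended so that words of length `k` become nearly Poisson distributed, words of length `k + 1` do
not, and short words keep their frequencies.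

One stage starts from a de Bruijn sequence of order `k`, in which every word of length `k` occurs
exactly once as a window (`exists_injOn_window`). It is cut into segments of length `k ^ 2`. A
second moment estimate over all words of length `k` shows that most segments have small discrepancy
for every short word; the good ones are grouped into `C` blocks of equal length `H`
(`eventually_exists_supply`), with `C` fixed and `C * H` close to `b ^ k`. Nearly every word of
length `k` then lies in exactly one block, exactly once. The stage appends `E = C * T` blocks in an
order `A`, with repetition. So a typical word occurs in the first `q * b ^ k` letters about as often
as its block is chosen among the first `q * C` choices. The order `A` comes from a deterministic
placement of balls into boxes whose occupancies at time `q * C` are exactly binomial, hence nearly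
Poisson with mean `q` (`exists_poisson_occupancy`).

The same repetition spoils words of length `k + 1`: apart from block boundaries and the prefix, only
`C * H ≤ b ^ k` of them occur at all, out of `b ^ (k + 1)`. So a proportion of about `1 - 1 / b ≥ 1
/ 2` is missing up to time `2 * b ^ (k + 1)`, whereas `exp (-2) < 1 / 4`.

Since `N` is polynomial in `k`, the prefix is negligible against `b ^ k`; since `k ^ 2` is small
against `N`, an incomplete segment never matters for normality (`eventually_exists_extension`).
Iterating with errors tending to zero gives the number. -/

namespace PoissonGeneric

/-! ### Digits of a real number, windows and discrepancy. -/

section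

theorem ofDigits_lt_one {b : ℕ} (d : ℕ → Fin b) (i : ℕ) (hi : (d i : ℕ) + 1 < b) :
    Real.ofDigits d < 1 := by
  have hb : 1 < b := by omega
  rw [← Real.ofDigits_const_last_eq_one' hb]
  refine Summable.tsum_lt_tsum (i := i) (fun n => ?_) ?_ Real.summable_ofDigitsTerm
    Real.summable_ofDigitsTerm
  · unfold Real.ofDigitsTerm
    have : ((d n : ℕ) : ℝ) ≤ ((b - 1 : ℕ) : ℝ) := by
      have := (d n).2
      exact_mod_cast (by omega : (d n : ℕ) ≤ b - 1)
    gcongr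
  · unfold Real.ofDigitsTerm
    have : ((d i : ℕ) : ℝ) < ((b - 1 : ℕ) : ℝ) := by
      exact_mod_cast (by omega : (d i : ℕ) < b - 1)
    have hb0 : (0 : ℝ) < b := by exact_mod_cast (by omega : 0 < b)
    exact mul_lt_mul_of_pos_right this (by positivity)

theorem exists_pow_mul_sum_ofDigitsTerm {b : ℕ} [NeZero b] (d : ℕ → Fin b) (n : ℕ) :
    ∃ M : ℕ, (b : ℝ) ^ n * ∑ i ∈ Finset.range n, Real.ofDigitsTerm d i = M := by
  induction n with
  | zero => exact ⟨0, by simp⟩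
  | succ n ih =>
    obtain ⟨M, hM⟩ := ih
    refine ⟨b * M + d n, ?_⟩
    have hb := NeZero.ne b
    rw [Finset.sum_range_succ, mul_add, pow_succ', mul_assoc, hM, Real.ofDigitsTerm, ← pow_succ',
      mul_left_comm, mul_inv_cancel₀ (by positivity)]
    push_cast
    ring

/-- Every tail contains a digit other than `b - 1`, so its value is strictly below `1` and taking
floors recovers the digits. -/
theorem digits_ofDigits {b : ℕ} [NeZero b] (d : ℕ → Fin b)
    (hd : ∀ n, ∃ i, (d (n + i) : ℕ) + 1 < b) : Real.digits (Real.ofDigits d) b = d := by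
  have hb := NeZero.ne b
  funext n
  obtain ⟨M, hM⟩ := exists_pow_mul_sum_ofDigitsTerm d n
  have key : Real.ofDigits d * (b : ℝ) ^ (n + 1) =
      ((b * M + d n : ℕ) : ℝ) + Real.ofDigits (fun i => d (i + (n + 1))) := by
    rw [Real.ofDigits_eq_sum_add_ofDigits d (n + 1), Finset.sum_range_succ, add_mul, add_mul,
      mul_comm (∑ i ∈ Finset.range n, _), pow_succ', mul_assoc, hM, Real.ofDigitsTerm, ← pow_succ',
      mul_assoc, inv_mul_cancel₀ (by positivity), mul_right_comm, inv_mul_cancel₀ (by positivity)]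
    push_cast
    ring
  have hlt : Real.ofDigits (fun i => d (i + (n + 1))) < 1 := by
    obtain ⟨i, hi⟩ := hd (n + 1)
    exact ofDigits_lt_one _ i (by rwa [add_comm i])
  have hfl : ⌊Real.ofDigits d * (b : ℝ) ^ (n + 1)⌋₊ = b * M + d n := by
    rw [key, Nat.floor_eq_iff (by have := Real.ofDigits_nonneg (fun i => d (i + (n + 1))); positivity)]
    have := Real.ofDigits_nonneg (fun i => d (i + (n + 1)))
    constructor <;> linarith
  apply Fin.ext
  rw [Real.digits, hfl, Fin.val_ofNat, Nat.mul_add_mod, Nat.mod_eq_of_lt (d n).2]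

/-- The word of length `k` read off the sequence `d` from position `i` on. -/
def window {b : ℕ} (k : ℕ) (d : ℕ → Fin b) (i : ℕ) : Fin k → Fin b := fun m => d (i + m)

theorem window_congr {b k : ℕ} {d c : ℕ → Fin b} {i j : ℕ}
    (h : ∀ r < k, d (i + r) = c (j + r)) : window k d i = window k c j :=
  funext fun m => h m m.2

theorem occ_eq_card_window {b k : ℕ} (d : ℕ → Fin b) (w : Fin k → Fin b) (n : ℕ) :
    occ d w n = ((Finset.range (n + 1 - k)).filter fun i => window k d i = w).card := by
  unfold occ
  congr 1
  ext i
  simp only [Finset.mem_filter, Finset.mem_range, funext_iff, window]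
  constructor
  · rintro ⟨h1, h2, h3⟩; exact ⟨by omega, h3⟩
  · rintro ⟨h1, h3⟩; exact ⟨by omega, by omega, h3⟩

/-- The indicator of an occurrence of `w` in `d` at position `i`, minus its expected value. -/
noncomputable def dev {b k : ℕ} (w : Fin k → Fin b) (d : ℕ → Fin b) (i : ℕ) : ℝ :=
  (if window k d i = w then 1 else 0) - ((b : ℝ) ^ k)⁻¹

/-- The discrepancy of `w` on the `n` positions of `d` from `a` on. -/
noncomputable def disc {b k : ℕ} (w : Fin k → Fin b) (d : ℕ → Fin b) (a n : ℕ) : ℝ :=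
  ∑ i ∈ Finset.range n, dev w d (a + i)

variable {b k : ℕ} (w : Fin k → Fin b)

theorem inv_pow_natCast_le_one (b k : ℕ) : ((b : ℝ) ^ k)⁻¹ ≤ 1 := by
  rcases Nat.eq_zero_or_pos b with rfl | hb
  · rcases Nat.eq_zero_or_pos k with rfl | hk
    · simp
    · simp [hk.ne']
  · exact inv_le_one_of_one_le₀ (one_le_pow₀ (by exact_mod_cast hb))

theorem abs_dev_le (d : ℕ → Fin b) (i : ℕ) : |dev w d i| ≤ 1 := by
  have h1 := inv_pow_natCast_le_one b k
  have h2 : (0 : ℝ) ≤ ((b : ℝ) ^ k)⁻¹ := by positivity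
  unfold dev
  rw [abs_le]
  split_ifs <;> constructor <;> linarith

theorem abs_disc_le (d : ℕ → Fin b) (a n : ℕ) : |disc w d a n| ≤ n := by
  refine (Finset.abs_sum_le_sum_abs _ _).trans ?_
  refine (Finset.sum_le_sum fun i _ => abs_dev_le w d (a + i)).trans ?_
  simp

theorem disc_add (d : ℕ → Fin b) (a m n : ℕ) :
    disc w d a (m + n) = disc w d a m + disc w d (a + m) n := by
  simp [disc, Finset.sum_range_add, add_assoc]

theorem dev_congr {d c : ℕ → Fin b} {i j : ℕ} (h : ∀ r < k, d (i + r) = c (j + r)) :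
    dev w d i = dev w c j := by
  unfold dev; rw [window_congr h]

theorem abs_dev_sub_dev_le (d c : ℕ → Fin b) (i j : ℕ) : |dev w d i - dev w c j| ≤ 1 := by
  unfold dev
  rw [sub_sub_sub_cancel_right]
  split_ifs <;> simp

/-- Discrepancy counts starting positions, so only the last `k` windows can see letters outside the
range of agreement. -/
theorem abs_disc_sub_disc_le {d c : ℕ → Fin b} {a a' n : ℕ}
    (h : ∀ r < n, d (a + r) = c (a' + r)) : |disc w d a n - disc w c a' n| ≤ k := by
  unfold disc
  rw [← Finset.sum_sub_distrib]
  refine (Finset.abs_sum_le_sum_abs _ _).trans ?_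
  calc ∑ i ∈ Finset.range n, |dev w d (a + i) - dev w c (a' + i)|
      ≤ ∑ i ∈ Finset.range n, (if n < i + k then (1 : ℝ) else 0) := by
        refine Finset.sum_le_sum fun i _ => ?_
        split_ifs with hi
        · exact abs_dev_sub_dev_le w d c _ _
        · rw [dev_congr w (d := d) (c := c) (i := a + i) (j := a' + i), sub_self, abs_zero]
          intro r hr
          rw [add_assoc, add_assoc]
          exact h _ (by omega)
    _ = (((Finset.range n).filter fun i => n < i + k).card : ℝ) := by simp
    _ ≤ k := by
        have : ((Finset.range n).filter fun i => n < i + k) ⊆ Finset.Ico (n - k) n := by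
          intro i; simp only [Finset.mem_filter, Finset.mem_range, Finset.mem_Ico]; omega
        have h2 := Finset.card_le_card this
        rw [Nat.card_Ico] at h2
        exact_mod_cast (by omega : _ ≤ k)

theorem abs_occ_sub_le (d : ℕ → Fin b) (n : ℕ) :
    |(occ d w n : ℝ) - n * ((b : ℝ) ^ k)⁻¹ - disc w d 0 n| ≤ k + 1 := by
  have h1 : disc w d 0 n = (((Finset.range n).filter fun i => window k d i = w).card : ℝ) -
      n * ((b : ℝ) ^ k)⁻¹ := by
    simp [disc, dev, Finset.sum_sub_distrib]
  rw [h1, occ_eq_card_window, sub_sub_sub_cancel_right]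
  have h2 : ((Finset.range (n + 1 - k)).filter fun i => window k d i = w).card ≤
      ((Finset.range n).filter fun i => window k d i = w).card + (k + 1) := by
    have : ((Finset.range (n + 1 - k)).filter fun i => window k d i = w) ⊆
        ((Finset.range n).filter fun i => window k d i = w) ∪ {n} := by
      intro i
      simp only [Finset.mem_filter, Finset.mem_range, Finset.mem_union, Finset.mem_singleton]
      rintro ⟨h, h'⟩
      by_cases hn : i = n
      · exact Or.inr hn
      · exact Or.inl ⟨by omega, h'⟩
    have := (Finset.card_le_card this).trans (Finset.card_union_le _ _)
    rw [Finset.card_singleton] at this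
    omega
  have h3 : ((Finset.range n).filter fun i => window k d i = w).card ≤
      ((Finset.range (n + 1 - k)).filter fun i => window k d i = w).card + (k + 1) := by
    have : ((Finset.range n).filter fun i => window k d i = w) ⊆
        ((Finset.range (n + 1 - k)).filter fun i => window k d i = w) ∪
          Finset.Ico (n + 1 - k) n := by
      intro i
      simp only [Finset.mem_filter, Finset.mem_range, Finset.mem_union, Finset.mem_Ico]
      rintro ⟨h, h'⟩
      by_cases hn : i < n + 1 - k
      · exact Or.inl ⟨hn, h'⟩
      · exact Or.inr ⟨by omega, h⟩
    have := (Finset.card_le_card this).trans (Finset.card_union_le _ _)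
    rw [Nat.card_Ico] at this
    omega
  rify at h2 h3
  rw [abs_le]
  constructor <;> linarith

theorem isNormal_of_tendsto_disc [NeZero b] {x : ℝ}
    (h : ∀ (k : ℕ) (w : Fin k → Fin b),
      Tendsto (fun n : ℕ => disc w (Real.digits x b) 0 n / n) atTop (𝓝 0)) : IsNormal b x := by
  intro k w
  have h1 := h k w
  have h2 : Tendsto (fun n : ℕ => ((k : ℝ) + 1) / n) atTop (𝓝 0) :=
    tendsto_const_div_atTop_nhds_zero_nat _
  have h3 : Tendsto (fun n : ℕ => ((occ (Real.digits x b) w n : ℝ) - n * ((b : ℝ) ^ k)⁻¹ -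
      disc w (Real.digits x b) 0 n) / n) atTop (𝓝 0) := by
    refine squeeze_zero_norm (fun n => ?_) h2
    rw [norm_div, Real.norm_eq_abs, Real.norm_natCast]
    gcongr
    exact abs_occ_sub_le w _ n
  have h4 := (h3.add h1).add_const (((b : ℝ) ^ k)⁻¹)
  rw [zero_add, zero_add] at h4
  refine h4.congr' ?_
  filter_upwards [eventually_gt_atTop 0] with n hn
  have : (n : ℝ) ≠ 0 := by positivity
  field_simp
  ring

end

/-! ### Second moment of the discrepancy over all words of length `k`. -/

section

/-- Each prescribed position leaves one choice and each other position leaves all of them. Applied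
to two disjoint windows, this is the independence of their contents. -/
theorem card_filter_comp_eq {ι κ β : Type*} [Fintype ι] [Fintype κ] [Fintype β] [DecidableEq ι]
    [DecidableEq κ] [DecidableEq β] (e : ι → κ) (he : Function.Injective e) (w : ι → β) :
    (Finset.univ.filter fun x : κ → β => ∀ m, x (e m) = w m).card * Fintype.card β ^ Fintype.card ι
      = Fintype.card β ^ Fintype.card κ := by
  have h1 : (Finset.univ.filter fun x : κ → β => ∀ m, x (e m) = w m) =
      Fintype.piFinset fun p => Finset.univ.filter fun a => ∀ m, e m = p → a = w m := by
    ext x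
    simp only [Finset.mem_filter, Finset.mem_univ, true_and, Fintype.mem_piFinset]
    constructor
    · rintro h p m rfl; exact h m
    · intro h m; exact h _ m rfl
  have h2 : ∀ p, (Finset.univ.filter fun a => ∀ m, e m = p → a = w m).card =
      if p ∈ Finset.univ.image e then 1 else Fintype.card β := by
    intro p
    split_ifs with hp
    · obtain ⟨m, -, rfl⟩ := Finset.mem_image.1 hp
      rw [Finset.card_eq_one]
      refine ⟨w m, ?_⟩
      ext a
      simp only [Finset.mem_filter, Finset.mem_univ, true_and, Finset.mem_singleton]
      exact ⟨fun h => h m rfl, fun h m' hm' => by rw [he hm', h]⟩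
    · rw [← Finset.card_univ]
      congr 1
      refine Finset.filter_true_of_mem fun a _ m hm => ?_
      exact absurd (Finset.mem_image.2 ⟨m, Finset.mem_univ _, hm⟩) hp
  rw [h1, Fintype.card_piFinset, Finset.prod_congr rfl fun p _ => h2 p, Finset.prod_ite,
    Finset.prod_const_one, one_mul, Finset.prod_const, ← pow_add]
  congr 1
  have h3 := Finset.card_filter_add_card_filter_not (s := (Finset.univ : Finset κ))
    (fun p => p ∈ Finset.univ.image e)
  rw [Finset.filter_mem_eq_inter, Finset.univ_inter, Finset.card_image_of_injective _ he,
    Finset.card_univ, Finset.card_univ] at h3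
  omega

/-- The sequence that starts with the word `x` and continues with zeros. -/
def extend {b k : ℕ} [NeZero b] (x : Fin k → Fin b) : ℕ → Fin b :=
  fun i => if h : i < k then x ⟨i, h⟩ else 0

variable {b k l : ℕ} [NeZero b] (w : Fin l → Fin b)

theorem window_extend_eq_iff {i : ℕ} (hi : i + l ≤ k) (x : Fin k → Fin b) :
    window l (extend x) i = w ↔ ∀ m : Fin l, x ⟨i + m, by omega⟩ = w m := by
  simp only [funext_iff, window, extend]
  refine forall_congr' fun m => ?_
  rw [dif_pos (by omega)]

theorem sum_ite_window_extend {i : ℕ} (hi : i + l ≤ k) :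
    ∑ x : Fin k → Fin b, (if window l (extend x) i = w then (1 : ℝ) else 0) =
      (b : ℝ) ^ k * ((b : ℝ) ^ l)⁻¹ := by
  have hb : (b : ℝ) ≠ 0 := by exact_mod_cast NeZero.ne b
  have h := card_filter_comp_eq (fun m : Fin l => (⟨i + m, by omega⟩ : Fin k))
    (fun m m' h => by simpa [Fin.ext_iff] using h) w
  simp only [Fintype.card_fin] at h
  simp only [window_extend_eq_iff w hi, Finset.sum_boole]
  rw [eq_mul_inv_iff_mul_eq₀ (by positivity)]
  norm_cast
  convert! h

theorem sum_ite_window_extend_mul {i j : ℕ} (hij : i + l ≤ j) (hj : j + l ≤ k) :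
    ∑ x : Fin k → Fin b, (if window l (extend x) i = w then (1 : ℝ) else 0) *
      (if window l (extend x) j = w then (1 : ℝ) else 0) =
      (b : ℝ) ^ k * (((b : ℝ) ^ l)⁻¹ * ((b : ℝ) ^ l)⁻¹) := by
  have hb : (b : ℝ) ≠ 0 := by exact_mod_cast NeZero.ne b
  have h := card_filter_comp_eq (Sum.elim (fun m : Fin l => (⟨i + m, by omega⟩ : Fin k))
    (fun m : Fin l => (⟨j + m, by omega⟩ : Fin k))) (by
      rintro (m | m) (m' | m') h <;> simp [Fin.ext_iff] at h ⊢ <;> omega) (Sum.elim w w)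
  simp only [Fintype.card_fin, Sum.forall, Sum.elim_inl, Sum.elim_inr, Fintype.card_sum] at h
  simp only [ite_zero_mul_ite_zero, mul_one, window_extend_eq_iff w (show i + l ≤ k by omega),
    window_extend_eq_iff w hj, Finset.sum_boole]
  rw [← mul_inv, ← pow_add, eq_mul_inv_iff_mul_eq₀ (by positivity)]
  norm_cast

theorem sum_dev_mul_dev_eq_zero {i j : ℕ} (hij : i + l ≤ j) (hj : j + l ≤ k) :
    ∑ x : Fin k → Fin b, dev w (extend x) i * dev w (extend x) j = 0 := by
  have h1 := sum_ite_window_extend w (k := k) (i := i) (by omega)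
  have h2 := sum_ite_window_extend w hj
  have h3 := sum_ite_window_extend_mul w hij hj
  simp only [dev, sub_mul, mul_sub, Finset.sum_sub_distrib, ← Finset.sum_mul, ← Finset.mul_sum,
    h1, h2, h3]
  simp
  ring

/-- After expanding the square, pairs of disjoint windows cancel; each position has at most `2 * l`
overlapping partners, each contributing at most `b ^ k`. -/
theorem sum_sq_disc_extend_le {h : ℕ} (hh : h + l ≤ k + 1) :
    ∑ x : Fin k → Fin b, disc w (extend x) 0 h ^ 2 ≤ 2 * l * h * (b : ℝ) ^ k := by
  have h1 : ∀ i ∈ Finset.range h, ∀ j ∈ Finset.range h,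
      ∑ x : Fin k → Fin b, dev w (extend x) i * dev w (extend x) j ≤
        if j < i + l ∧ i < j + l then (b : ℝ) ^ k else 0 := by
    intro i hi j hj
    rw [Finset.mem_range] at hi hj
    split_ifs with hij
    · refine (Finset.sum_le_sum (g := fun _ => (1 : ℝ)) fun x _ => ?_).trans (by simp)
      refine (le_abs_self _).trans ?_
      rw [abs_mul]
      exact mul_le_one₀ (abs_dev_le _ _ _) (abs_nonneg _) (abs_dev_le _ _ _)
    · rcases not_and_or.1 hij with hij | hij
      · exact (sum_dev_mul_dev_eq_zero w (by omega) (by omega)).le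
      · simp only [mul_comm (dev w (extend _) i)]
        exact (sum_dev_mul_dev_eq_zero w (by omega) (by omega)).le
  calc ∑ x : Fin k → Fin b, disc w (extend x) 0 h ^ 2
      = ∑ i ∈ Finset.range h, ∑ j ∈ Finset.range h,
          ∑ x : Fin k → Fin b, dev w (extend x) i * dev w (extend x) j := by
        simp only [disc, sq, Finset.sum_mul_sum, zero_add]
        rw [Finset.sum_comm]
        exact Finset.sum_congr rfl fun i _ => Finset.sum_comm
    _ ≤ ∑ i ∈ Finset.range h, ∑ j ∈ Finset.range h,
          if j < i + l ∧ i < j + l then (b : ℝ) ^ k else 0 :=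
        Finset.sum_le_sum fun i hi => Finset.sum_le_sum fun j hj => h1 i hi j hj
    _ ≤ ∑ i ∈ Finset.range h, (2 * l) * (b : ℝ) ^ k := by
        refine Finset.sum_le_sum fun i _ => ?_
        rw [← Finset.sum_filter, Finset.sum_const, nsmul_eq_mul]
        gcongr
        have : ((Finset.range h).filter fun j => j < i + l ∧ i < j + l) ⊆
            Finset.Ico (i + 1 - l) (i + l) := by
          intro j; simp only [Finset.mem_filter, Finset.mem_range, Finset.mem_Ico]; omega
        have h2 := Finset.card_le_card this
        rw [Nat.card_Ico] at h2
        exact_mod_cast (by omega : _ ≤ 2 * l)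
    _ = 2 * l * h * (b : ℝ) ^ k := by simp; ring

theorem disc_window {d : ℕ → Fin b} {i h : ℕ} (hh : h + l ≤ k + 1) :
    disc w (extend (window k d i)) 0 h = disc w d i h := by
  refine Finset.sum_congr rfl fun r hr => dev_congr w fun s hs => ?_
  rw [Finset.mem_range] at hr
  simp only [extend, window]
  rw [dif_pos (by omega)]
  congr 1
  omega

/-- The windows of a de Bruijn sequence run through all words once, so the sum over positions is a
sum over words; Cauchy–Schwarz and the second moment bound conclude. -/
theorem sum_abs_disc_le {d : ℕ → Fin b} {h : ℕ} (hh : h + l ≤ k + 1)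
    (hd : Set.InjOn (window k d) (Set.Iio (b ^ k))) {η : ℝ} (hη : 0 < η) (hlh : 2 * l ≤ η ^ 2 * h) :
    ∑ i ∈ Finset.range (b ^ k), |disc w d i h| ≤ η * h * (b : ℝ) ^ k := by
  have hdd : ∀ i ∈ Finset.range (b ^ k), ∀ j ∈ Finset.range (b ^ k),
      window k d i = window k d j → i = j :=
    fun i hi j hj hij => hd (Finset.mem_range.1 hi) (Finset.mem_range.1 hj) hij
  have h1 : ∑ i ∈ Finset.range (b ^ k), disc w d i h ^ 2 ≤ 2 * l * h * (b : ℝ) ^ k := by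
    refine le_trans ?_ (sum_sq_disc_extend_le w hh)
    rw [← Finset.sum_subset (Finset.subset_univ ((Finset.range (b ^ k)).image (window k d)))
      fun x _ hx => ?_, Finset.sum_image hdd]
    · simp only [disc_window w hh, le_refl]
    · have : (Finset.range (b ^ k)).image (window k d) = Finset.univ := by
        apply Finset.eq_univ_of_card
        rw [Finset.card_image_of_injOn hdd]
        simp
      exact absurd (this ▸ Finset.mem_univ x) hx
  have h2 := sq_sum_le_card_mul_sum_sq (s := Finset.range (b ^ k)) (f := fun i => |disc w d i h|)
  simp only [sq_abs, Finset.card_range, Nat.cast_pow] at h2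
  refine abs_le_of_sq_le_sq' ?_ (by positivity) |>.2
  refine h2.trans ?_
  calc (b : ℝ) ^ k * ∑ i ∈ Finset.range (b ^ k), disc w d i h ^ 2
      ≤ (b : ℝ) ^ k * (2 * l * h * (b : ℝ) ^ k) := by gcongr
    _ ≤ (b : ℝ) ^ k * ((η ^ 2 * h) * h * (b : ℝ) ^ k) := by gcongr
    _ = (η * h * (b : ℝ) ^ k) ^ 2 := by ring

end

/-! ### De Bruijn sequences, by merging cycles of a permutation of words. -/

section

theorem iterate_perm_mul_swap {α : Type*} [DecidableEq α] (T : Equiv.Perm α) (u v : α)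
    {x : α} {n : ℕ} (h : ∀ i < n, (T ^ i) x ≠ u ∧ (T ^ i) x ≠ v) :
    ((T * Equiv.swap u v) ^ n) x = (T ^ n) x := by
  induction n with
  | zero => rfl
  | succ n ih =>
    have := h n (by omega)
    rw [pow_succ', pow_succ', Equiv.Perm.mul_apply, Equiv.Perm.mul_apply,
      ih fun i hi => h i (by omega), Equiv.Perm.mul_apply,
      Equiv.swap_apply_of_ne_of_ne this.1 this.2]

/-- The new permutation sends `v` to `T u` and then runs along the old cycle of `u`, which avoids
`v`, until it reaches `u`. -/
theorem sameCycle_perm_mul_swap {α : Type*} [DecidableEq α] [Finite α] {T : Equiv.Perm α}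
    {u v : α} (huv : ¬ T.SameCycle u v) : (T * Equiv.swap u v).SameCycle u v := by
  have hex : ∃ p, 0 < p ∧ (T ^ p) u = u :=
    ⟨orderOf T, orderOf_pos T, by rw [pow_orderOf_eq_one]; rfl⟩
  classical
  obtain ⟨hp, hpu⟩ := Nat.find_spec hex
  have hmin : ∀ i, 0 < i → i < Nat.find hex → (T ^ i) u ≠ u := fun i h0 hi h =>
    Nat.find_min hex hi ⟨h0, h⟩
  obtain ⟨q, hq⟩ : ∃ q, Nat.find hex = q + 1 := Nat.exists_eq_add_one.2 hp
  rw [hq] at hpu hmin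
  refine Equiv.Perm.SameCycle.symm ⟨(q + 1 : ℕ), ?_⟩
  rw [zpow_natCast, pow_succ, Equiv.Perm.mul_apply, Equiv.Perm.mul_apply, Equiv.swap_apply_right,
    iterate_perm_mul_swap]
  · rw [← Equiv.Perm.mul_apply, ← pow_succ, hpu]
  · intro i hi
    rw [← Equiv.Perm.mul_apply, ← pow_succ]
    exact ⟨hmin _ (by omega) (by omega), fun h => huv ⟨(i + 1 : ℕ), by rw [zpow_natCast, h]⟩⟩

theorem SameCycle.perm_mul_swap {α : Type*} [DecidableEq α] [Finite α] {T : Equiv.Perm α}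
    {u v x y : α} (huv : ¬ T.SameCycle u v) (hxy : T.SameCycle x y) :
    (T * Equiv.swap u v).SameCycle x y := by
  have h0 := sameCycle_perm_mul_swap huv
  have hstep : ∀ z, (T * Equiv.swap u v).SameCycle z (T z) := by
    intro z
    have h1 : ∀ z', (T * Equiv.swap u v).SameCycle z' ((T * Equiv.swap u v) z') := fun z' =>
      ⟨1, by simp⟩
    by_cases hu : z = u
    · subst hu
      have := h1 v
      rw [Equiv.Perm.mul_apply, Equiv.swap_apply_right] at this
      exact h0.trans this
    by_cases hv : z = v
    · subst hv
      have := h1 u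
      rw [Equiv.Perm.mul_apply, Equiv.swap_apply_left] at this
      exact h0.symm.trans this
    · have := h1 z
      rwa [Equiv.Perm.mul_apply, Equiv.swap_apply_of_ne_of_ne hu hv] at this
  obtain ⟨n, rfl⟩ := hxy.exists_nat_pow_eq
  clear hxy
  induction n with
  | zero => rfl
  | succ n ih =>
    rw [pow_succ', Equiv.Perm.mul_apply]
    exact ih.trans (hstep _)

/-- `v` arises from `u` by deleting the first letter and appending another one. -/
def Follows {b k : ℕ} (u v : Fin k → Fin b) : Prop :=
  ∀ (i : ℕ) (h : i + 1 < k), v ⟨i, by omega⟩ = u ⟨i + 1, h⟩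

/-- Appending the letters of `y` one at a time to any member of `O` produces `y` after `k` steps. -/
theorem mem_of_closed_follows {b k : ℕ} [NeZero b] {O : Set (Fin k → Fin b)}
    (hne : O.Nonempty) (hO : ∀ u ∈ O, ∀ v, Follows u v → v ∈ O) (y : Fin k → Fin b) : y ∈ O := by
  have : ∀ j ≤ k, ∃ z ∈ O, ∀ (i : ℕ) (h : i < j) (h' : k - j + i < k),
      z ⟨k - j + i, h'⟩ = y ⟨i, by omega⟩ := by
    intro j
    induction j with
    | zero => exact fun _ => ⟨hne.some, hne.some_mem, fun i h => absurd h (by omega)⟩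
    | succ j ih =>
      intro hj
      obtain ⟨z, hz, hzy⟩ := ih (by omega)
      refine ⟨fun i => if h : (i : ℕ) + 1 < k then z ⟨i + 1, h⟩ else y ⟨j, hj⟩,
        hO z hz _ fun i h => by simp [h], fun i h h' => ?_⟩
      by_cases hi : i < j
      · have := hzy i hi (by omega)
        simp only [show k - (j + 1) + i + 1 < k by omega, dif_pos, ← this]
        congr 2
        omega
      · obtain rfl : i = j := by omega
        simp only [show ¬ (k - (i + 1) + i + 1 < k) by omega, dif_neg, not_false_iff]
  obtain ⟨z, hz, h⟩ := this k le_rfl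
  convert! hz
  funext i
  have := h i i.2 (by omega)
  rw [show i = ⟨(i : ℕ), i.2⟩ from rfl, ← this]
  congr 2
  omega

/-- Among permutations respecting `Follows`, take one whose cycle through the zero word is largest.
If this cycle were not closed under `Follows`, two words with a common tail could exchange
successors, which would merge another cycle into it. -/
theorem exists_perm_follows_sameCycle {b k : ℕ} [NeZero b] :
    ∃ T : Equiv.Perm (Fin k → Fin b), (∀ w, Follows w (T w)) ∧
      ∀ w, T.SameCycle (fun _ => 0) w := by
  classical
  set x0 : Fin k → Fin b := fun _ => 0
  let S : Finset (Equiv.Perm (Fin k → Fin b)) := Finset.univ.filter fun T => ∀ w, Follows w (T w)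
  have hS : S.Nonempty := by
    -- Cyclic rotation of words respects `Follows`.
    refine ⟨(Equiv.arrowCongr (finRotate k) (Equiv.refl _)).symm, ?_⟩
    rw [Finset.mem_filter]
    refine ⟨Finset.mem_univ _, fun w i h => ?_⟩
    obtain ⟨k, rfl⟩ : ∃ n, k = n + 1 := ⟨k - 1, by omega⟩
    simp [Equiv.arrowCongr, finRotate_of_lt (show i < k by omega)]
  obtain ⟨T, hT, hmax⟩ := S.exists_max_image
    (fun T => (Finset.univ.filter fun w => T.SameCycle x0 w).card) hS
  have hTf : ∀ w, Follows w (T w) := (Finset.mem_filter.1 hT).2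
  refine ⟨T, hTf, mem_of_closed_follows (O := {w | T.SameCycle x0 w}) ⟨x0, .refl _ _⟩ ?_⟩
  intro u hu s hus
  by_contra hs
  set v := T⁻¹ s with hv
  have hTv : T v = s := by simp [hv]
  have hv' : ¬ T.SameCycle x0 v := fun h => hs (by
    rw [← hTv]; exact (Equiv.Perm.sameCycle_apply_right).2 h)
  have huv : ¬ T.SameCycle u v := fun h => hv' (Equiv.Perm.SameCycle.trans hu h)
  have htail : ∀ (i : ℕ) (h : i + 1 < k), u ⟨i + 1, h⟩ = v ⟨i + 1, h⟩ := fun i h => by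
    rw [← hus i h, ← hTf v i h, hTv]
  have hT' : T * Equiv.swap u v ∈ S := by
    refine Finset.mem_filter.2 ⟨Finset.mem_univ _, fun w i h => ?_⟩
    rw [Equiv.Perm.mul_apply]
    by_cases hwu : w = u
    · rw [hwu, Equiv.swap_apply_left, hTf v i h, htail i h]
    by_cases hwv : w = v
    · rw [hwv, Equiv.swap_apply_right, hTf u i h, htail i h]
    · rw [Equiv.swap_apply_of_ne_of_ne hwu hwv, hTf w i h]
  refine absurd (hmax _ hT') (not_le.2 (Finset.card_lt_card ?_))
  refine Finset.ssubset_iff_subset_ne.2 ⟨fun w hw => ?_, fun h => ?_⟩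
  · rw [Finset.mem_filter] at hw ⊢
    exact ⟨hw.1, SameCycle.perm_mul_swap huv hw.2⟩
  · refine hv' (Finset.mem_filter.1 (h.symm ▸ Finset.mem_filter.2 ⟨Finset.mem_univ v, ?_⟩ :
      v ∈ Finset.univ.filter fun w => T.SameCycle x0 w)).2
    exact (SameCycle.perm_mul_swap huv hu).trans (sameCycle_perm_mul_swap huv)

/-- Existence of de Bruijn sequences. -/
theorem exists_injOn_window {b k : ℕ} [NeZero b] (hk : 0 < k) :
    ∃ d : ℕ → Fin b, Set.InjOn (window k d) (Set.Iio (b ^ k)) := by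
  obtain ⟨T, hT, hcyc⟩ := exists_perm_follows_sameCycle (b := b) (k := k)
  set x0 : Fin k → Fin b := fun _ => 0
  refine ⟨fun i => (T ^ i) x0 ⟨0, hk⟩, ?_⟩
  have hw : ∀ m (hm : m < k) i, (T ^ (i + m)) x0 ⟨0, hk⟩ = (T ^ i) x0 ⟨m, hm⟩ := by
    intro m
    induction m with
    | zero => intro _ i; rfl
    | succ m ih =>
      intro hm i
      rw [show i + (m + 1) = i + 1 + m by ring, ih (by omega), pow_succ', Equiv.Perm.mul_apply,
        hT _ m hm]
  have hw' : ∀ i, window k (fun i => (T ^ i) x0 ⟨0, hk⟩) i = (T ^ i) x0 := fun i =>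
    funext fun m => hw m m.2 i
  -- An earlier return would confine the orbit to fewer than `b ^ k` words, but it contains all of
  -- them.
  have hper : ∀ p, 0 < p → p < b ^ k → (T ^ p) x0 ≠ x0 := by
    intro p hp hpb hpx
    have hmod : ∀ n q, (T ^ (p * q + n)) x0 = (T ^ n) x0 := by
      intro n q
      induction q with
      | zero => simp
      | succ q ih =>
        rw [show p * (q + 1) + n = p * q + n + p by ring, pow_add, Equiv.Perm.mul_apply, hpx, ih]
    have hsurj : (Finset.univ : Finset (Fin k → Fin b)) ⊆
        (Finset.range p).image fun n => (T ^ n) x0 := by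
      intro w _
      obtain ⟨n, hn⟩ := (hcyc w).exists_nat_pow_eq
      refine Finset.mem_image.2 ⟨n % p, Finset.mem_range.2 (Nat.mod_lt _ hp), ?_⟩
      rw [← hn, ← hmod (n % p) (n / p), Nat.div_add_mod]
    have := (Finset.card_le_card hsurj).trans Finset.card_image_le
    simp at this
    omega
  have hlt : ∀ i j, i < j → j < b ^ k → (T ^ i) x0 ≠ (T ^ j) x0 := by
    intro i j hij hj h
    refine hper (j - i) (by omega) (by omega) ?_
    apply (T ^ i).injective
    rw [← Equiv.Perm.mul_apply, ← pow_add, h]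
    congr 2
    omega
  intro i hi j hj hij
  rw [hw', hw'] at hij
  rcases lt_trichotomy i j with h | h | h
  · exact absurd hij (hlt i j h hj)
  · exact h
  · exact absurd hij.symm (hlt j i h hi)

end

/-! ### Good segments of a de Bruijn sequence and their grouping into blocks. -/

section

theorem tendsto_natCast_pow_div_pow {b : ℕ} (hb : 2 ≤ b) (p : ℕ) :
    Tendsto (fun k : ℕ => (k : ℝ) ^ p / (b : ℝ) ^ k) atTop (𝓝 0) :=
  tendsto_pow_const_div_const_pow_of_one_lt p (by exact_mod_cast hb)

theorem eventually_mul_pow_le {b : ℕ} (hb : 2 ≤ b) (p : ℕ) (A : ℝ) {ε : ℝ} (hε : 0 < ε) :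
    ∀ᶠ k : ℕ in atTop, A * (k : ℝ) ^ p ≤ ε * (b : ℝ) ^ k := by
  have h := (tendsto_natCast_pow_div_pow hb p).const_mul A
  rw [mul_zero] at h
  filter_upwards [h.eventually_le_const hε] with k hk
  have hb0 : (0 : ℝ) < (b : ℝ) ^ k := pow_pos (by exact_mod_cast (by omega : 0 < b)) k
  rwa [← mul_div_assoc, div_le_iff₀ hb0] at hk

/-- Double counting: summing the short discrepancies over `L` starting points is summing the long
one over `h` shifts, and each shift changes the latter by at most `2 * h`. -/
theorem mul_abs_disc_le {b l : ℕ} (w : Fin l → Fin b) (d : ℕ → Fin b) (a h L : ℕ) :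
    h * |disc w d a L| ≤ ∑ i ∈ Finset.range L, |disc w d (a + i) h| + 2 * (h : ℝ) ^ 2 := by
  have h1 : ∀ r ∈ Finset.range h, |disc w d (a + r) L - disc w d a L| ≤ 2 * h := by
    intro r hr
    rw [Finset.mem_range] at hr
    have e1 := disc_add w d a r L
    have e2 := disc_add w d a L r
    rw [add_comm r L] at e1
    have h3 := abs_disc_le w d a r
    have h4 := abs_disc_le w d (a + L) r
    have hr' : (r : ℝ) ≤ h := by exact_mod_cast hr.le
    rw [abs_le] at *
    constructor <;> linarith
  have h2 : ∑ i ∈ Finset.range L, disc w d (a + i) h =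
      ∑ r ∈ Finset.range h, disc w d (a + r) L := by
    unfold disc
    rw [Finset.sum_comm]
    exact Finset.sum_congr rfl fun r _ => Finset.sum_congr rfl fun i _ => by rw [add_right_comm]
  have h3 : (h : ℝ) * disc w d a L = ∑ i ∈ Finset.range L, disc w d (a + i) h -
      ∑ r ∈ Finset.range h, (disc w d (a + r) L - disc w d a L) := by
    rw [h2, Finset.sum_sub_distrib]; simp
  calc (h : ℝ) * |disc w d a L| = |(h : ℝ) * disc w d a L| := by
        rw [abs_mul, Nat.abs_cast]
    _ ≤ |∑ i ∈ Finset.range L, disc w d (a + i) h| +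
        |∑ r ∈ Finset.range h, (disc w d (a + r) L - disc w d a L)| := by
        rw [h3]; exact abs_sub _ _
    _ ≤ ∑ i ∈ Finset.range L, |disc w d (a + i) h| + ∑ r ∈ Finset.range h, 2 * (h : ℝ) :=
        add_le_add (Finset.abs_sum_le_sum_abs _ _)
          ((Finset.abs_sum_le_sum_abs _ _).trans (Finset.sum_le_sum h1))
    _ = _ := by simp; ring

theorem sum_range_mul_eq (f : ℕ → ℝ) (R L : ℕ) :
    ∑ a ∈ Finset.range R, ∑ i ∈ Finset.range L, f (a * L + i) =
      ∑ i ∈ Finset.range (R * L), f i := by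
  induction R with
  | zero => simp
  | succ R ih => rw [Finset.sum_range_succ, ih, Nat.succ_mul, Finset.sum_range_add]

variable {b : ℕ} [NeZero b]

/-- Averaging over short stretches of length `h = k + 1 - l` bounds the total discrepancy of the
segments; Markov's inequality bounds the number of bad ones. -/
theorem eventually_card_bad_segments_le {l : ℕ} (w : Fin l → Fin b) {ε η : ℝ} (hε : 0 < ε)
    (hη : 0 < η) : ∀ᶠ k : ℕ in atTop, ∀ d : ℕ → Fin b,
      Set.InjOn (window k d) (Set.Iio (b ^ k)) →
      (((Finset.range (b ^ k / k ^ 2)).filter fun a =>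
        ε * (k : ℝ) ^ 2 < |disc w d (a * k ^ 2) (k ^ 2)|).card : ℝ) * (k : ℝ) ^ 2 ≤
          η * (b : ℝ) ^ k := by
  set δ : ℝ := ε * η / 2 with hδ
  have hδ0 : 0 < δ := by positivity
  have h1 : ∀ᶠ k : ℕ in atTop, 2 * l / δ ^ 2 + l ≤ (k : ℝ) :=
    tendsto_natCast_atTop_atTop.eventually_ge_atTop _
  have h2 : ∀ᶠ k : ℕ in atTop, 4 / δ ≤ (k : ℝ) :=
    tendsto_natCast_atTop_atTop.eventually_ge_atTop _
  filter_upwards [h1, h2, eventually_ge_atTop (l + 1), eventually_ge_atTop 1]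
    with k hk1 hk2 hkl hk0 d hd
  set L := k ^ 2 with hL
  set R := b ^ k / L with hR
  obtain ⟨h, hh⟩ : ∃ h, k + 1 = h + l := ⟨k + 1 - l, by omega⟩
  have hh0 : 0 < h := by omega
  have hhk : (h : ℝ) ≤ k + 1 := by exact_mod_cast (by omega : h ≤ k + 1)
  have hk1' : (1 : ℝ) ≤ k := by exact_mod_cast hk0
  have hRL : R * L ≤ b ^ k := Nat.div_mul_le_self _ _
  have hh' : (k : ℝ) + 1 = h + l := by exact_mod_cast hh
  have hsum : ∑ i ∈ Finset.range (b ^ k), |disc w d i h| ≤ δ * h * (b : ℝ) ^ k := by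
    refine sum_abs_disc_le w (by omega) hd hδ0 ?_
    have : 2 * l / δ ^ 2 ≤ h := by linarith
    rwa [div_le_iff₀' (by positivity)] at this
  have hseg : h * ∑ a ∈ Finset.range R, |disc w d (a * L) L| ≤
      h * (δ * (b : ℝ) ^ k + R * (2 * h)) := by
    calc (h : ℝ) * ∑ a ∈ Finset.range R, |disc w d (a * L) L|
        ≤ ∑ a ∈ Finset.range R,
          (∑ i ∈ Finset.range L, |disc w d (a * L + i) h| + 2 * (h : ℝ) ^ 2) := by
          rw [Finset.mul_sum]
          exact Finset.sum_le_sum fun a _ => mul_abs_disc_le w d _ h L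
      _ = ∑ i ∈ Finset.range (R * L), |disc w d i h| + R * (2 * (h : ℝ) ^ 2) := by
          rw [Finset.sum_add_distrib, sum_range_mul_eq (fun i => |disc w d i h|)]
          simp
      _ ≤ δ * h * (b : ℝ) ^ k + R * (2 * (h : ℝ) ^ 2) := by
          refine add_le_add_left ((Finset.sum_le_sum_of_subset_of_nonneg ?_ ?_).trans hsum) _
          · exact Finset.range_subset_range.2 hRL
          · exact fun _ _ _ => abs_nonneg _
      _ = _ := by ring
  have hseg' := le_of_mul_le_mul_left hseg (by exact_mod_cast hh0)
  set B := (Finset.range R).filter fun a => ε * (k : ℝ) ^ 2 < |disc w d (a * L) L| with hB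
  have hBsum : B.card * (ε * (k : ℝ) ^ 2) ≤ ∑ a ∈ Finset.range R, |disc w d (a * L) L| := by
    rw [← nsmul_eq_mul]
    refine (Finset.card_nsmul_le_sum B _ _ fun a ha => (Finset.mem_filter.1 ha).2.le).trans ?_
    exact Finset.sum_le_sum_of_subset_of_nonneg (Finset.filter_subset _ _)
      fun _ _ _ => abs_nonneg _
  have hRk : (R : ℝ) * (2 * h) ≤ δ * (b : ℝ) ^ k := by
    have e1 : (R : ℝ) * (k : ℝ) ^ 2 ≤ (b : ℝ) ^ k := by exact_mod_cast hRL
    rw [div_le_iff₀ hδ0] at hk2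
    calc (R : ℝ) * (2 * h) ≤ R * (4 * k) := mul_le_mul_of_nonneg_left (by linarith) (Nat.cast_nonneg _)
      _ ≤ R * ((k * δ) * k) := by gcongr
      _ = δ * (R * (k : ℝ) ^ 2) := by ring
      _ ≤ δ * (b : ℝ) ^ k := by gcongr
  have : ε * (B.card * (k : ℝ) ^ 2) ≤ ε * (η * (b : ℝ) ^ k) := by
    calc ε * (B.card * (k : ℝ) ^ 2) = B.card * (ε * (k : ℝ) ^ 2) := by ring
      _ ≤ δ * (b : ℝ) ^ k + δ * (b : ℝ) ^ k := by linarith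
      _ = _ := by rw [hδ]; ring
  exact le_of_mul_le_mul_left this hε

theorem eventually_exists_good_segments (hb : 2 ≤ b) (n : ℕ) {ε η : ℝ} (hε : 0 < ε) (hη : 0 < η) :
    ∀ᶠ k : ℕ in atTop, ∀ d : ℕ → Fin b, Set.InjOn (window k d) (Set.Iio (b ^ k)) →
      ∃ G ⊆ Finset.range (b ^ k / k ^ 2), (1 - η) * (b : ℝ) ^ k ≤ G.card * (k : ℝ) ^ 2 ∧
        ∀ a ∈ G, ∀ l ≤ n, ∀ w : Fin l → Fin b,
          |disc w d (a * k ^ 2) (k ^ 2)| ≤ ε * (k : ℝ) ^ 2 := by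
  let W := Σ l : Fin (n + 1), (Fin l → Fin b)
  set M : ℝ := 2 * (Fintype.card W + 1) with hM
  have hM0 : 0 < M := by positivity
  have h1 : ∀ᶠ k : ℕ in atTop, ∀ v : W, ∀ d : ℕ → Fin b,
      Set.InjOn (window k d) (Set.Iio (b ^ k)) →
      (((Finset.range (b ^ k / k ^ 2)).filter fun a =>
        ε * (k : ℝ) ^ 2 < |disc v.2 d (a * k ^ 2) (k ^ 2)|).card : ℝ) * (k : ℝ) ^ 2 ≤
          η / M * (b : ℝ) ^ k :=
    eventually_all.2 fun v => eventually_card_bad_segments_le v.2 hε (by positivity)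
  filter_upwards [h1, eventually_mul_pow_le hb 2 1 (half_pos hη), eventually_ge_atTop 1]
    with k hk1 hk2 hk0 d hd
  set R := b ^ k / k ^ 2 with hR
  let B : W → Finset ℕ := fun v => (Finset.range R).filter fun a =>
    ε * (k : ℝ) ^ 2 < |disc v.2 d (a * k ^ 2) (k ^ 2)|
  refine ⟨Finset.range R \ Finset.univ.biUnion B, Finset.sdiff_subset, ?_, ?_⟩
  · have e1 : (b : ℝ) ^ k ≤ R * (k : ℝ) ^ 2 + (k : ℝ) ^ 2 := by
      have := Nat.lt_div_mul_add (a := b ^ k) (b := k ^ 2) (by positivity)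
      exact_mod_cast this.le
    have e2 : R ≤ (Finset.range R \ Finset.univ.biUnion B).card + ∑ v : W, (B v).card := by
      have := Finset.le_card_sdiff (Finset.univ.biUnion B) (Finset.range R)
      have h3 := Finset.card_biUnion_le (s := (Finset.univ : Finset W)) (t := B)
      rw [Finset.card_range] at this
      omega
    have e3 : (∑ v : W, ((B v).card : ℝ)) * (k : ℝ) ^ 2 ≤ η / 2 * (b : ℝ) ^ k := by
      rw [Finset.sum_mul]
      refine (Finset.sum_le_sum fun v _ => hk1 v d hd).trans ?_
      rw [Finset.sum_const, nsmul_eq_mul, Finset.card_univ, ← mul_assoc]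
      gcongr
      rw [← mul_div_assoc, div_le_div_iff₀ hM0 two_pos, hM]
      nlinarith
    have e4 : (R : ℝ) * (k : ℝ) ^ 2 ≤ ((Finset.range R \ Finset.univ.biUnion B).card +
        ∑ v : W, ((B v).card : ℝ)) * (k : ℝ) ^ 2 := by
      gcongr
      exact_mod_cast e2
    rw [add_mul] at e4
    linarith
  · intro a ha l hl w
    rw [Finset.mem_sdiff, Finset.mem_biUnion] at ha
    by_contra hcon
    exact ha.2 ⟨⟨⟨l, by omega⟩, w⟩, Finset.mem_univ _, Finset.mem_filter.2 ⟨ha.1, not_le.1 hcon⟩⟩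

theorem exists_injOn_enumeration (G : Finset ℕ) :
    ∃ σ : ℕ → ℕ, Set.InjOn σ (Set.Iio G.card) ∧ ∀ n < G.card, σ n ∈ G := by
  refine ⟨fun n => if h : n < G.card then G.orderEmbOfFin rfl ⟨n, h⟩ else 0, ?_, ?_⟩
  · intro i hi j hj hij
    rw [Set.mem_Iio] at hi hj
    simp only [hi, hj, dif_pos, EmbeddingLike.apply_eq_iff_eq, Fin.mk.injEq] at hij
    exact hij
  · intro n hn
    simp only [hn, dif_pos]
    exact G.orderEmbOfFin_mem rfl _

theorem eventually_exists_supply (hb : 2 ≤ b) {C : ℕ} (hC : 0 < C) (n : ℕ) {ε : ℝ} (hε : 0 < ε) :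
    ∀ᶠ k : ℕ in atTop, ∃ (g : ℕ) (V : Fin C → ℕ → Fin b) (S : Finset ℕ),
      C * (g * k ^ 2) ≤ b ^ k ∧ (∀ r ∈ S, r + k ≤ g * k ^ 2) ∧
      (1 - ε) * (b : ℝ) ^ k ≤ C * S.card ∧
      (∀ c c' r r', r ∈ S → r' ∈ S → window k (V c) r = window k (V c') r' → c = c' ∧ r = r') ∧
      ∀ c, ∀ q < g, ∀ l ≤ n, ∀ w : Fin l → Fin b,
        |disc w (V c) (q * k ^ 2) (k ^ 2)| ≤ ε * (k : ℝ) ^ 2 := by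
  have h1 : ∀ᶠ k : ℕ in atTop, 4 / ε ≤ (k : ℝ) :=
    tendsto_natCast_atTop_atTop.eventually_ge_atTop _
  have h2 : ∀ᶠ k : ℕ in atTop, 2 * n / ε ≤ (k : ℝ) :=
    tendsto_natCast_atTop_atTop.eventually_ge_atTop _
  filter_upwards [eventually_exists_good_segments hb n (half_pos hε) (half_pos hε), h1, h2,
    eventually_mul_pow_le hb 2 C (show 0 < ε / 4 by positivity), eventually_ge_atTop 1]
    with k hk hk1 hk2 hkC hk0
  obtain ⟨d, hd⟩ := exists_injOn_window (b := b) (k := k) (by omega)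
  obtain ⟨G, hGR, hG, hdisc⟩ := hk d hd
  obtain ⟨σ, hσ, hσG⟩ := exists_injOn_enumeration G
  have hk1' : (1 : ℝ) ≤ k := by exact_mod_cast hk0
  have hkk : k ≤ k ^ 2 := by nlinarith
  set L := k ^ 2 with hL
  have hL0 : 0 < L := by positivity
  have hLr : (L : ℝ) = (k : ℝ) ^ 2 := by rw [hL]; push_cast; rfl
  set g := G.card / C with hg
  have hCg : C * g ≤ G.card := Nat.mul_div_le _ _
  have hGL : G.card * L ≤ b ^ k := by
    have := Finset.card_le_card hGR
    rw [Finset.card_range] at this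
    exact (Nat.mul_le_mul_right _ this).trans (Nat.div_mul_le_self _ _)
  have hidx : ∀ (c : Fin C) (q : ℕ), q < g → c * g + q < G.card := by
    intro c q hq
    have : ((c : ℕ) + 1) * g ≤ C * g := Nat.mul_le_mul_right _ c.2
    nlinarith
  -- Block `c` joins the good segments numbered `c * g` to `c * g + g - 1`; fewer than `C` good
  -- segments are left over.
  let V : Fin C → ℕ → Fin b := fun c r => d (σ (c * g + r / L) * L + r % L)
  have hV : ∀ c q ρ, ρ < L → V c (q * L + ρ) = d (σ (c * g + q) * L + ρ) := by
    intro c q ρ hρ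
    simp only [V]
    rw [Nat.mul_comm q L, Nat.mul_add_div hL0, Nat.mul_add_mod, Nat.div_eq_of_lt hρ,
      Nat.mod_eq_of_lt hρ, add_zero]
  have hwin : ∀ c q ρ, ρ + k ≤ L →
      window k (V c) (q * L + ρ) = window k d (σ (c * g + q) * L + ρ) := by
    intro c q ρ hρ
    refine window_congr fun r hr => ?_
    rw [add_assoc, add_assoc, hV c q (ρ + r) (by omega)]
  have hlin : ∀ q q' ρ ρ', ρ < L → ρ' < L → q * L + ρ = q' * L + ρ' → q = q' ∧ ρ = ρ' := by
    intro q q' ρ ρ' h h' e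
    have e1 := congrArg (· / L) e
    have e2 := congrArg (· % L) e
    simp only [Nat.mul_comm _ L, Nat.mul_add_div hL0, Nat.mul_add_mod, Nat.div_eq_of_lt h,
      Nat.div_eq_of_lt h', Nat.mod_eq_of_lt h, Nat.mod_eq_of_lt h'] at e1 e2
    exact ⟨by omega, e2⟩
  -- Positions whose window of length `k` stays inside one segment; fewer than `k` of each `k ^ 2`
  -- are lost.
  let S : Finset ℕ := (Finset.range g ×ˢ Finset.range (L - k + 1)).image fun p => p.1 * L + p.2
  have hS : ∀ r ∈ S, ∃ q ρ, q < g ∧ ρ + k ≤ L ∧ q * L + ρ = r := by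
    intro r hr
    obtain ⟨⟨q, ρ⟩, hp, rfl⟩ := Finset.mem_image.1 hr
    rw [Finset.mem_product, Finset.mem_range, Finset.mem_range] at hp
    simp only at hp
    exact ⟨q, ρ, hp.1, by omega, rfl⟩
  have hScard : S.card = g * (L - k + 1) := by
    rw [Finset.card_image_of_injOn, Finset.card_product, Finset.card_range, Finset.card_range]
    rintro ⟨q, ρ⟩ hp ⟨q', ρ'⟩ hp' e
    simp only [Finset.coe_product, Finset.coe_range, Set.mem_prod, Set.mem_Iio] at hp hp'
    obtain ⟨rfl, rfl⟩ := hlin q q' ρ ρ' (by omega) (by omega) e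
    rfl
  refine ⟨g, V, S, ?_, ?_, ?_, ?_, ?_⟩
  · calc C * (g * L) = C * g * L := by ring
      _ ≤ G.card * L := Nat.mul_le_mul_right _ hCg
      _ ≤ b ^ k := hGL
  · intro r hr
    obtain ⟨q, ρ, hq, hρ, rfl⟩ := hS r hr
    have : (q + 1) * L ≤ g * L := Nat.mul_le_mul_right _ hq
    nlinarith
  · have e1 : (G.card : ℝ) ≤ C * g + C := by
      have := Nat.lt_mul_div_succ G.card hC
      exact_mod_cast (by rw [← hg] at this; nlinarith : G.card ≤ C * g + C)
    have e2 : (S.card : ℝ) = g * (L - k + 1) := by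
      rw [hScard]; push_cast [Nat.cast_sub hkk]; rfl
    have e3 : (G.card : ℝ) * L ≤ (b : ℝ) ^ k := by exact_mod_cast hGL
    have e4 : (G.card : ℝ) * k ≤ ε / 4 * (b : ℝ) ^ k := by
      rw [div_le_iff₀ hε] at hk1
      calc (G.card : ℝ) * k = 1 / 4 * (G.card * (4 * k)) := by ring
        _ ≤ 1 / 4 * (G.card * ((k * ε) * k)) := by gcongr
        _ = ε / 4 * (G.card * (L : ℝ)) := by rw [hLr]; ring
        _ ≤ _ := by gcongr
    have hkL : (k : ℝ) ≤ L := by exact_mod_cast hkk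
    rw [← hLr] at hG hkC
    have e5 : (G.card : ℝ) * (L - k) ≤ (C * g + C) * (L - k) :=
      mul_le_mul_of_nonneg_right e1 (by linarith)
    have e6 : (0 : ℝ) ≤ C * g := by positivity
    have e7 : (0 : ℝ) ≤ C * k := by positivity
    rw [e2]
    linarith
  · intro c c' r r' hr hr' h
    obtain ⟨q, ρ, hq, hρ, rfl⟩ := hS r hr
    obtain ⟨q', ρ', hq', hρ', rfl⟩ := hS r' hr'
    rw [hwin c q ρ hρ, hwin c' q' ρ' hρ'] at h
    have hbd : ∀ (c : Fin C) q ρ, q < g → ρ + k ≤ L → σ (c * g + q) * L + ρ ∈ Set.Iio (b ^ k) := by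
      intro c q ρ hq hρ
      have h1 := Finset.mem_range.1 (hGR (hσG _ (hidx c q hq)))
      have h2 : (σ (c * g + q) + 1) * L ≤ b ^ k :=
        (Nat.mul_le_mul_right _ h1).trans (Nat.div_mul_le_self _ _)
      rw [Set.mem_Iio]
      nlinarith
    obtain ⟨e1, rfl⟩ := hlin _ _ _ _ (by omega) (by omega)
      (hd (hbd c q ρ hq hρ) (hbd c' q' ρ' hq' hρ') h)
    have e2 := hσ (hidx c q hq) (hidx c' q' hq') e1
    have hg0 : 0 < g := by omega
    have e3 := congrArg (· / g) e2
    have e4 := congrArg (· % g) e2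
    simp only [Nat.mul_comm _ g, Nat.mul_add_div hg0, Nat.mul_add_mod, Nat.div_eq_of_lt hq,
      Nat.div_eq_of_lt hq', Nat.mod_eq_of_lt hq, Nat.mod_eq_of_lt hq', add_zero] at e3 e4
    exact ⟨Fin.ext e3, by rw [e4]⟩
  · intro c q hq l hl w
    have e1 := abs_disc_sub_disc_le w (d := V c) (c := d) (a := q * L) (a' := σ (c * g + q) * L)
      (n := L) fun r hr => hV c q r hr
    have e2 := hdisc _ (hσG _ (hidx c q hq)) l hl w
    have e3 : (l : ℝ) ≤ n := by exact_mod_cast hl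
    have e4 : (n : ℝ) ≤ ε / 2 * (k : ℝ) ^ 2 := by
      rw [div_le_iff₀ hε] at hk2
      nlinarith
    have := abs_add_le (disc w (V c) (q * L) L - disc w d (σ (c * g + q) * L) L)
      (disc w d (σ (c * g + q) * L) L)
    rw [sub_add_cancel] at this
    linarith

end

/-! ### Deterministic balls in boxes with nearly Poisson occupancies. -/

section

-- The generating function of the number of hits is `(X + m) ^ t * (m + 1) ^ (n - t)`; compare
-- coefficients of `X ^ j`.
open Polynomial in
theorem card_filter_card_hits_eq {n m t : ℕ} (j : ℕ) (ht : t ≤ n) :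
    (Finset.univ.filter fun c : Fin n → Fin (m + 1) =>
      (Finset.univ.filter fun τ : Fin n => (τ : ℕ) < t ∧ c τ = 0).card = j).card =
        m ^ (t - j) * t.choose j * (m + 1) ^ (n - t) := by
  have h1 : ∑ c : Fin n → Fin (m + 1),
      (X : ℕ[X]) ^ (Finset.univ.filter fun τ : Fin n => (τ : ℕ) < t ∧ c τ = 0).card =
        (X + C m) ^ t * C ((m + 1) ^ (n - t)) := by
    have h2 : ∀ τ : Fin n, ∑ a : Fin (m + 1), (if (τ : ℕ) < t ∧ a = 0 then (X : ℕ[X]) else 1) =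
        if (τ : ℕ) < t then X + C m else C (m + 1) := by
      intro τ
      rw [Fin.sum_univ_succ]
      by_cases hτ : (τ : ℕ) < t
      · simp [hτ, Fin.succ_ne_zero]
      · simp [hτ, add_comm]
    have h3 := Finset.prod_univ_sum (fun _ : Fin n => (Finset.univ : Finset (Fin (m + 1))))
      (fun τ a => if (τ : ℕ) < t ∧ a = 0 then (X : ℕ[X]) else 1)
    simp only [h2, Fintype.piFinset_univ] at h3
    rw [Fin.prod_univ_eq_prod_range (fun i => if i < t then (X : ℕ[X]) + C m else C (m + 1)) n,
      ← Finset.prod_range_mul_prod_Ico _ ht,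
      Finset.prod_congr rfl fun i hi => if_pos (Finset.mem_range.1 hi),
      Finset.prod_congr (rfl : Finset.Ico t n = _)
        fun i hi => if_neg (not_lt.2 (Finset.mem_Ico.1 hi).1)] at h3
    simp only [Finset.prod_const, Finset.card_range, Nat.card_Ico] at h3
    rw [C_pow, h3]
    refine Finset.sum_congr rfl fun c _ => ?_
    rw [Finset.prod_ite]
    simp
  have h4 := congrArg (fun p : ℕ[X] => p.coeff j) h1
  simp only [finsetSum_coeff, coeff_X_pow, coeff_mul_C, coeff_X_add_C_pow] at h4
  rw [← Nat.cast_id (t.choose j), ← h4, Finset.card_filter]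
  simp only [eq_comm]

/-- Boxes are vectors `c`, and round `τ` puts one ball into each box with `c τ = 0`. After `t`
rounds the occupancy of a uniformly chosen box is binomial with parameters `t` and `1 / (m + 1)`. -/
theorem exists_round_sequence (s m : ℕ) :
    ∃ B : ℕ → (Fin (s + 1) → Fin (m + 1)), ∀ t ≤ s + 1, ∀ c,
      ((Finset.range (t * (m + 1) ^ s)).filter fun i => B i = c).card =
        (Finset.univ.filter fun τ : Fin (s + 1) => (τ : ℕ) < t ∧ c τ = 0).card := by
  have hG : 0 < (m + 1) ^ s := by positivity
  set G := (m + 1) ^ s with hGdef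
  -- Ball `i` belongs to round `i / G`; the remainder `i % G` enumerates the other coordinates of
  -- its box.
  refine ⟨fun i => Fin.insertNth (α := fun _ => Fin (m + 1)) (Fin.ofNat (s + 1) (i / G)) 0
    (finFunctionFinEquiv.symm ⟨i % G, Nat.mod_lt _ hG⟩), fun t ht c => ?_⟩
  symm
  refine Finset.card_bij (fun τ _ => (τ : ℕ) * G + finFunctionFinEquiv (Fin.removeNth τ c)) ?_ ?_ ?_
  · intro τ hτ
    simp only [Finset.mem_filter, Finset.mem_univ, true_and, Finset.mem_range] at hτ ⊢
    have h2 : (finFunctionFinEquiv (Fin.removeNth τ c) : ℕ) < G := (finFunctionFinEquiv _).2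
    have h3 : ((τ : ℕ) + 1) * G ≤ t * G := Nat.mul_le_mul_right _ hτ.1
    refine ⟨by linarith, ?_⟩
    have h4 : ((τ : ℕ) * G + finFunctionFinEquiv (Fin.removeNth τ c)) / G = τ := by
      rw [Nat.mul_comm, Nat.mul_add_div hG, Nat.div_eq_of_lt h2, add_zero]
    have h5 : ((τ : ℕ) * G + finFunctionFinEquiv (Fin.removeNth τ c)) % G =
        finFunctionFinEquiv (Fin.removeNth τ c) := by
      rw [Nat.mul_comm, Nat.mul_add_mod, Nat.mod_eq_of_lt h2]
    have h6 : Fin.ofNat (s + 1) (τ : ℕ) = τ := Fin.ext (Nat.mod_eq_of_lt τ.2)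
    simp only [h4, h5, h6, Fin.insertNth_eq_iff, hτ.2, true_and]
    rw [Equiv.symm_apply_eq]
  · intro τ hτ τ' hτ' h
    have h2 : (finFunctionFinEquiv (Fin.removeNth τ c) : ℕ) < G := (finFunctionFinEquiv _).2
    have h2' : (finFunctionFinEquiv (Fin.removeNth τ' c) : ℕ) < G := (finFunctionFinEquiv _).2
    have e := congrArg (· / G) h
    simp only [Nat.mul_comm _ G, Nat.mul_add_div hG, Nat.div_eq_of_lt h2, Nat.div_eq_of_lt h2',
      add_zero] at e
    exact Fin.ext e
  · intro i hi
    simp only [Finset.mem_filter, Finset.mem_range, Fin.insertNth_eq_iff] at hi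
    obtain ⟨hi, h0, h1⟩ := hi
    have h3 : i / G < t := (Nat.div_lt_iff_lt_mul hG).2 hi
    have h4 : ((Fin.ofNat (s + 1) (i / G) : Fin (s + 1)) : ℕ) = i / G :=
      Nat.mod_eq_of_lt (by omega)
    refine ⟨Fin.ofNat (s + 1) (i / G), ?_, ?_⟩
    · simp only [Finset.mem_filter, Finset.mem_univ, true_and]
      exact ⟨by rw [h4]; exact h3, h0.symm⟩
    · rw [← h1, Equiv.apply_symm_apply, h4]
      exact Nat.div_add_mod' i G

theorem binomial_ratio_eq {n m t : ℕ} (j : ℕ) (ht : t ≤ n) :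
    ((m ^ (t - j) * t.choose j * (m + 1) ^ (n - t) : ℕ) : ℝ) / ((m + 1) ^ n : ℕ) =
      t.choose j * (1 / (m + 1 : ℝ)) ^ j * (1 - 1 / (m + 1 : ℝ)) ^ (t - j) := by
  by_cases hj : j ≤ t
  · obtain ⟨r, rfl⟩ := Nat.exists_eq_add_of_le ht
    obtain ⟨q, rfl⟩ := Nat.exists_eq_add_of_le hj
    have hm : (m + 1 : ℝ) ≠ 0 := by positivity
    rw [one_sub_div hm, add_sub_cancel_right]
    simp only [Nat.add_sub_cancel_left, div_pow, one_pow]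
    push_cast
    rw [pow_add _ (j + q) r, pow_add _ j q]
    field_simp
  · simp [Nat.choose_eq_zero_of_lt (not_le.1 hj)]

/-- Balls can be placed into boxes so that at each of the prescribed times the occupancy numbers
are nearly Poisson distributed. -/
theorem exists_poisson_occupancy (Q : Finset ℚ) (hQ : ∀ q ∈ Q, 0 < q) (J : ℕ) {ε : ℝ}
    (hε : 0 < ε) :
    ∃ C > 0, ∃ A : ℕ → Fin C, ∀ q ∈ Q, ∃ e : ℕ, (e : ℝ) = q * C ∧ ∀ j ≤ J,
      |((Finset.univ.filter fun c => ((Finset.range e).filter fun i => A i = c).card = j).card : ℝ)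
        / C - poissonWeight q j| < ε := by
  -- With a common denominator `D`, taking `r q * (M + 1)` rounds and hit probability `1 / (D * (M +
  -- 1))` gives mean exactly `q` for all `q ∈ Q` simultaneously.
  set D : ℕ := ∏ q ∈ Q, q.den with hD
  have hD0 : 0 < D := Finset.prod_pos fun q _ => q.den_pos
  have hr : ∀ q ∈ Q, ∃ r : ℕ, 0 < r ∧ (r : ℝ) = (q : ℝ) * D := by
    intro q hq
    obtain ⟨D', hD'⟩ := Finset.dvd_prod_of_mem (fun q : ℚ => q.den) hq
    obtain ⟨a, ha⟩ := Int.eq_ofNat_of_zero_le (Rat.num_pos.2 (hQ q hq)).le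
    have ha0 : 0 < a := by have := Rat.num_pos.2 (hQ q hq); omega
    refine ⟨a * D', Nat.mul_pos ha0 (Nat.pos_of_ne_zero fun h => ?_), ?_⟩
    · rw [← hD, h, mul_zero] at hD'; omega
    · rw [hD, hD']
      have h1 : (q : ℝ) * q.den = a := by
        have h2 : (q : ℝ) * q.den = q.num := by exact_mod_cast Rat.mul_den_eq_num q
        rw [h2, ha]; rfl
      push_cast
      rw [← mul_assoc, h1]
  choose! r hr0 hr using hr
  have hlim : ∀ q ∈ Q, ∀ j, Tendsto (fun M : ℕ => ((r q * (M + 1)).choose j : ℝ) *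
      (1 / (D * (M + 1) : ℝ)) ^ j * (1 - 1 / (D * (M + 1) : ℝ)) ^ (r q * (M + 1) - j)) atTop
      (𝓝 (poissonWeight q j)) := by
    intro q hq j
    have h1 : Tendsto (fun n : ℕ => (n : ℝ) * ((q : ℝ) / n)) atTop (𝓝 (q : ℝ)) := by
      refine tendsto_const_nhds.congr' ?_
      filter_upwards [eventually_gt_atTop 0] with n hn
      field_simp
    have h2 : Tendsto (fun M : ℕ => r q * (M + 1)) atTop atTop :=
      tendsto_atTop_mono (fun M => (Nat.le_succ M).trans (Nat.le_mul_of_pos_left _ (hr0 q hq))) tendsto_id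
    refine ((ProbabilityTheory.tendsto_choose_mul_pow_of_tendsto_mul_atTop j h1).comp h2).congr ?_
    intro M
    have hq0 : (q : ℝ) ≠ 0 := by exact_mod_cast (hQ q hq).ne'
    have h3 : (q : ℝ) / ((r q * (M + 1) : ℕ) : ℝ) = 1 / (D * (M + 1) : ℝ) := by
      push_cast
      rw [hr q hq]
      field_simp
    simp only [Function.comp_apply, h3]
  have hev : ∀ᶠ M : ℕ in atTop, ∀ q ∈ Q, ∀ j ∈ Finset.range (J + 1),
      |((r q * (M + 1)).choose j : ℝ) * (1 / (D * (M + 1) : ℝ)) ^ j *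
        (1 - 1 / (D * (M + 1) : ℝ)) ^ (r q * (M + 1) - j) - poissonWeight q j| < ε := by
    rw [Finset.eventually_all]
    intro q hq
    rw [Finset.eventually_all]
    intro j _
    exact (Metric.tendsto_nhds.1 (hlim q hq j)) ε hε
  obtain ⟨M, hM⟩ := hev.exists
  obtain ⟨m, hm⟩ : ∃ m, D * (M + 1) = m + 1 := Nat.exists_eq_add_one.2 (by positivity)
  have hmr : (D * (M + 1) : ℝ) = m + 1 := by exact_mod_cast hm
  simp only [hmr] at hM
  -- A crude bound for the number of rounds needed by every `q ∈ Q`.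
  set s := ∑ q ∈ Q, r q * (M + 1) with hs
  obtain ⟨B, hB⟩ := exists_round_sequence s m
  refine ⟨(m + 1) ^ (s + 1), by positivity, fun i => finFunctionFinEquiv (B i), fun q hq =>
    ⟨r q * (M + 1) * (m + 1) ^ s, ?_, fun j hj => ?_⟩⟩
  · push_cast
    rw [hr q hq, pow_succ, ← hmr]
    ring
  · have ht : r q * (M + 1) ≤ s + 1 :=
      (Finset.single_le_sum (f := fun q => r q * (M + 1)) (fun _ _ => Nat.zero_le _) hq).trans
        (Nat.le_succ _)
    have h1 : (Finset.univ.filter fun c : Fin ((m + 1) ^ (s + 1)) =>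
        ((Finset.range (r q * (M + 1) * (m + 1) ^ s)).filter
          fun i => finFunctionFinEquiv (B i) = c).card = j).card =
        (Finset.univ.filter fun c : Fin (s + 1) → Fin (m + 1) =>
          (Finset.univ.filter fun τ : Fin (s + 1) =>
            (τ : ℕ) < r q * (M + 1) ∧ c τ = 0).card = j).card := by
      symm
      refine Finset.card_equiv finFunctionFinEquiv fun c => ?_
      simp only [Finset.mem_filter, Finset.mem_univ, true_and, EmbeddingLike.apply_eq_iff_eq,
        hB _ ht c]
    rw [h1, card_filter_card_hits_eq j ht, binomial_ratio_eq j ht]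
    exact hM q hq j (Finset.mem_range.2 (by omega))

end

/-! ### From block occupancies to word counts of lengths `k` and `k + 1`. -/

section

/-- A value counted differently by `I` and `J` is attained on their symmetric difference. -/
theorem card_filter_card_ne_le {α : Type*} [Fintype α] [DecidableEq α] (φ : ℕ → α)
    (I J : Finset ℕ) :
    (Finset.univ.filter fun w => (I.filter fun i => φ i = w).card ≠
      (J.filter fun i => φ i = w).card).card ≤ (I \ J).card + (J \ I).card := by
  refine le_trans (Finset.card_le_card (t := ((I \ J) ∪ (J \ I)).image φ) fun w hw => ?_)
    (Finset.card_image_le.trans (Finset.card_union_le _ _))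
  rw [Finset.mem_filter] at hw
  by_contra hcon
  refine hw.2 (congrArg _ (Finset.ext fun i => ?_))
  simp only [Finset.mem_filter]
  by_cases hi : φ i = w
  · have : ¬ (i ∈ (I \ J) ∪ (J \ I)) := fun h => hcon (Finset.mem_image.2 ⟨i, h, hi⟩)
    simp only [Finset.mem_union, Finset.mem_sdiff] at this
    tauto
  · tauto

theorem abs_card_fiber_sub_le {α : Type*} [Fintype α] (f g : α → ℕ) (j : ℕ) :
    |((Finset.univ.filter fun w => f w = j).card : ℝ) -
      (Finset.univ.filter fun w => g w = j).card| ≤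
        (Finset.univ.filter fun w => f w ≠ g w).card := by
  classical
  have key : ∀ f g : α → ℕ, (Finset.univ.filter fun w => f w = j).card ≤
      (Finset.univ.filter fun w => g w = j).card +
        (Finset.univ.filter fun w => f w ≠ g w).card := by
    intro f g
    refine le_trans (Finset.card_le_card fun w hw => ?_) (Finset.card_union_le _ _)
    simp only [Finset.mem_union, Finset.mem_filter, Finset.mem_univ, true_and] at hw ⊢
    by_cases h : f w = g w
    · exact Or.inl (h ▸ hw)
    · exact Or.inr h
  have h1 := key f g
  have h2 := key g f
  simp only [ne_comm (a := g _)] at h2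
  rw [← Nat.cast_le (α := ℝ), Nat.cast_add] at h1 h2
  rw [abs_le]
  constructor <;> linarith

/-- The proportion of words of length `k` which occur exactly `j` times among the first
`⌊l b ^ k + k⌋` terms of the sequence `d`. -/
noncomputable def seqZ {b : ℕ} (d : ℕ → Fin b) (l : ℝ) (j k : ℕ) : ℝ :=
  ((Finset.univ.filter
    (fun w : Fin k → Fin b => occ d w ⌊l * (b : ℝ) ^ k + k⌋₊ = j)).card : ℝ) / (b : ℝ) ^ k

theorem occ_floor_eq_card {b k : ℕ} (d : ℕ → Fin b) {l : ℝ} (hl : 0 ≤ l) (w : Fin k → Fin b) :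
    occ d w ⌊l * (b : ℝ) ^ k + k⌋₊ =
      ((Finset.range (⌊l * (b : ℝ) ^ k⌋₊ + 1)).filter fun i => window k d i = w).card := by
  rw [occ_eq_card_window, Nat.floor_add_natCast (by positivity)]
  congr 3
  omega

variable {b C k N H E : ℕ} {d : ℕ → Fin b} {V : Fin C → ℕ → Fin b} {A : ℕ → Fin C}

/-- From position `N` on, `d` consists of the words `V (A 0), …, V (A (E - 1))` of length `H`. -/
def IsConcat (d : ℕ → Fin b) (N H E : ℕ) (V : Fin C → ℕ → Fin b) (A : ℕ → Fin C) : Prop :=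
  ∀ a < E, ∀ r < H, d (N + (a * H + r)) = V (A a) r

theorem IsConcat.window_eq (hd : IsConcat d N H E V A) {a r : ℕ} (ha : a < E) (hr : r + k ≤ H) :
    window k d (N + (a * H + r)) = window k (V (A a)) r :=
  window_congr fun s hs => by
    rw [← hd a ha (r + s) (by omega)]
    congr 1
    omega

theorem mul_add_inj {H a a' r r' : ℕ} (hr : r < H) (hr' : r' < H) (h : a * H + r = a' * H + r') :
    a = a' ∧ r = r' := by
  have hH : 0 < H := by omega
  have e1 := congrArg (· / H) h
  have e2 := congrArg (· % H) h
  simp only [Nat.mul_comm _ H, Nat.mul_add_div hH, Nat.mul_add_mod, Nat.div_eq_of_lt hr,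
    Nat.div_eq_of_lt hr', Nat.mod_eq_of_lt hr, Nat.mod_eq_of_lt hr'] at e1 e2
  exact ⟨by omega, e2⟩

/-- A word read at a position of `S` in block `c` is counted once per choice of `c`. Thus each box
of occupancy `j` contributes `S.card` words; the error is the number of words in no block. -/
theorem IsConcat.abs_card_filter_sub_le [NeZero b] (hd : IsConcat d N H E V A) {S : Finset ℕ}
    (hS : ∀ r ∈ S, r + k ≤ H) (hk : 0 < k)
    (hinj : ∀ c c' r r', r ∈ S → r' ∈ S → window k (V c) r = window k (V c') r' → c = c' ∧ r = r')
    {e : ℕ} (he : e ≤ E) (j : ℕ) :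
    |((Finset.univ.filter fun w => (((Finset.range e ×ˢ S).image
      fun p => N + (p.1 * H + p.2)).filter fun i => window k d i = w).card = j).card : ℝ) -
      S.card * (Finset.univ.filter fun c =>
        ((Finset.range e).filter fun i => A i = c).card = j).card| ≤
      (b : ℝ) ^ k - C * S.card := by
  set I := (Finset.range e ×ˢ S).image fun p : ℕ × ℕ => N + (p.1 * H + p.2) with hI
  set X := Finset.univ.filter fun c => ((Finset.range e).filter fun i => A i = c).card = j with hX
  have hcount : ∀ c, ∀ r ∈ S, (I.filter fun i => window k d i = window k (V c) r).card =
      ((Finset.range e).filter fun i => A i = c).card := by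
    intro c r hr
    symm
    refine Finset.card_bij (fun a _ => N + (a * H + r)) ?_ ?_ ?_
    · intro a ha
      rw [Finset.mem_filter, Finset.mem_range] at ha
      rw [Finset.mem_filter, hd.window_eq (by omega) (hS r hr), ha.2]
      refine ⟨Finset.mem_image.2 ⟨(a, r), ?_, rfl⟩, rfl⟩
      exact Finset.mem_product.2 ⟨Finset.mem_range.2 ha.1, hr⟩
    · intro a _ a' _ h
      have := hS r hr
      exact (mul_add_inj (by omega) (by omega) (Nat.add_left_cancel h)).1
    · intro i hi
      rw [Finset.mem_filter] at hi
      obtain ⟨hi, hw⟩ := hi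
      obtain ⟨⟨a, r'⟩, hp, rfl⟩ := Finset.mem_image.1 hi
      rw [Finset.mem_product, Finset.mem_range] at hp
      simp only at hp hw
      rw [hd.window_eq (by omega) (hS r' hp.2)] at hw
      obtain ⟨h1, rfl⟩ := hinj _ _ _ _ hp.2 hr hw
      exact ⟨a, Finset.mem_filter.2 ⟨Finset.mem_range.2 hp.1, h1⟩, rfl⟩
  have hinj' : Set.InjOn (fun p : Fin C × ℕ => window k (V p.1) p.2)
      ((Finset.univ : Finset (Fin C)) ×ˢ S : Finset (Fin C × ℕ)) := by
    rintro ⟨c, r⟩ hp ⟨c', r'⟩ hp' h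
    rw [Finset.mem_coe, Finset.mem_product] at hp hp'
    obtain ⟨rfl, rfl⟩ := hinj c c' r r' hp.2 hp'.2 h
    rfl
  set U := ((Finset.univ : Finset (Fin C)) ×ˢ S).image fun p : Fin C × ℕ => window k (V p.1) p.2
    with hU
  have hUcard : U.card = C * S.card := by
    rw [hU, Finset.card_image_of_injOn hinj', Finset.card_product, Finset.card_univ,
      Fintype.card_fin]
  have hUc : (Uᶜ.card : ℝ) = (b : ℝ) ^ k - C * S.card := by
    have := Finset.card_compl_add_card U
    rw [hUcard] at this
    simp only [Fintype.card_pi, Fintype.card_fin, Finset.prod_const, Finset.card_univ] at this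
    have h2 : (Uᶜ.card : ℝ) + C * S.card = (b : ℝ) ^ k := by exact_mod_cast this
    linarith
  have hXU : (U.filter fun w => (I.filter fun i => window k d i = w).card = j).card =
      X.card * S.card := by
    rw [← Finset.card_product, hU, Finset.filter_image, Finset.card_image_of_injOn
      (hinj'.mono (Finset.coe_subset.2 (Finset.filter_subset _ _)))]
    congr 1
    ext ⟨c, r⟩
    simp only [Finset.mem_filter, Finset.mem_product, Finset.mem_univ, true_and, hX]
    constructor
    · rintro ⟨h1, h2⟩; exact ⟨by rwa [hcount c r h1] at h2, h1⟩
    · rintro ⟨h1, h2⟩; exact ⟨h2, by rwa [hcount c r h2]⟩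
  have hlow : X.card * S.card ≤
      (Finset.univ.filter fun w => (I.filter fun i => window k d i = w).card = j).card := by
    rw [← hXU]
    exact Finset.card_le_card (Finset.filter_subset_filter _ (Finset.subset_univ _))
  have hup : (Finset.univ.filter fun w => (I.filter fun i => window k d i = w).card = j).card ≤
      X.card * S.card + Uᶜ.card := by
    rw [← hXU]
    refine le_trans (Finset.card_le_card fun w hw => ?_) (Finset.card_union_le _ _)
    rw [Finset.mem_union, Finset.mem_filter, Finset.mem_compl]
    by_cases h : w ∈ U
    · exact Or.inl ⟨h, (Finset.mem_filter.1 hw).2⟩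
    · exact Or.inr h
  rw [← Nat.cast_le (α := ℝ), Nat.cast_mul] at hlow
  rw [← Nat.cast_le (α := ℝ), Nat.cast_add, Nat.cast_mul] at hup
  rw [← hUc, abs_le, mul_comm (S.card : ℝ)]
  have := Nat.cast_nonneg (α := ℝ) Uᶜ.card
  constructor <;> linarith

/-- The shift by `N` pushes at most `N` block positions out of the initial range; the other
difference then follows by comparing cardinalities. -/
theorem IsConcat.card_symmDiff_le {S : Finset ℕ} (hk : 0 < k)
    (hS : ∀ r ∈ S, r + k ≤ H) {e : ℕ} {x δ : ℝ} (hx : (e * H : ℕ) ≤ x)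
    (hxS : x - δ ≤ e * S.card) :
    (((Finset.range (⌊x⌋₊ + 1) \ (Finset.range e ×ˢ S).image
        fun p : ℕ × ℕ => N + (p.1 * H + p.2)).card +
      ((Finset.range e ×ˢ S).image (fun p : ℕ × ℕ => N + (p.1 * H + p.2)) \
        Finset.range (⌊x⌋₊ + 1)).card : ℕ) : ℝ) ≤ 2 * N + 1 + δ := by
  set I := (Finset.range e ×ˢ S).image fun p : ℕ × ℕ => N + (p.1 * H + p.2) with hI
  set R := Finset.range (⌊x⌋₊ + 1) with hR
  have hx0 : 0 ≤ x := (Nat.cast_nonneg _).trans hx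
  have hIcard : I.card = e * S.card := by
    rw [hI, Finset.card_image_of_injOn, Finset.card_product, Finset.card_range]
    rintro ⟨a, r⟩ hp ⟨a', r'⟩ hp' h
    rw [Finset.mem_coe, Finset.mem_product] at hp hp'
    have h1 := hS r hp.2
    have h2 := hS r' hp'.2
    obtain ⟨rfl, rfl⟩ := mul_add_inj (by omega) (by omega) (Nat.add_left_cancel h)
    rfl
  have hIR : (I \ R).card ≤ N := by
    have hfl : e * H ≤ ⌊x⌋₊ := Nat.le_floor hx
    have : I \ R ⊆ Finset.Ico (e * H) (N + e * H) := by
      intro i hi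
      rw [Finset.mem_sdiff, hR, Finset.mem_range] at hi
      obtain ⟨⟨a, r⟩, hp, rfl⟩ := Finset.mem_image.1 hi.1
      rw [Finset.mem_product, Finset.mem_range] at hp
      have h1 := hS r hp.2
      have h2 : (a + 1) * H ≤ e * H := Nat.mul_le_mul_right _ hp.1
      rw [Finset.mem_Ico]
      simp only at *
      constructor <;> nlinarith
    have := Finset.card_le_card this
    rw [Nat.card_Ico] at this
    omega
  have e1 := Finset.card_sdiff_add_card_inter R I
  have e2 := Finset.card_sdiff_add_card_inter I R
  rw [Finset.inter_comm] at e2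
  have e3 : R.card = ⌊x⌋₊ + 1 := Finset.card_range _
  have e4 := Nat.floor_le hx0
  rify at e1 e2 hIR e3 hIcard
  push_cast
  linarith

/-- Poisson distribution of the numbers of occurrences from Poisson occupancy of the boxes. -/
theorem IsConcat.abs_seqZ_sub_le [NeZero b] (hd : IsConcat d N H E V A) {S : Finset ℕ}
    (hS : ∀ r ∈ S, r + k ≤ H) (hk : 0 < k) (hC : 0 < C)
    (hinj : ∀ c c' r r', r ∈ S → r' ∈ S → window k (V c) r = window k (V c') r' → c = c' ∧ r = r')
    (hCH : C * H ≤ b ^ k) {δ : ℝ} (hCS : (1 - δ) * (b : ℝ) ^ k ≤ C * S.card)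
    {e : ℕ} (he : e ≤ E) {q : ℝ} (hq : 0 ≤ q) (heq : (e : ℝ) = q * C) (j : ℕ) :
    |seqZ d q j k - ((Finset.univ.filter fun c =>
      ((Finset.range e).filter fun i => A i = c).card = j).card : ℝ) / C| ≤
      (2 * N + 1) / (b : ℝ) ^ k + (q + 2) * δ := by
  have hb0 : (0 : ℝ) < (b : ℝ) ^ k := by
    have := NeZero.pos b
    positivity
  have hC0 : (0 : ℝ) < C := by exact_mod_cast hC
  have hx : ((e * H : ℕ) : ℝ) ≤ q * (b : ℝ) ^ k := by
    push_cast
    rw [heq, mul_assoc]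
    have : (C : ℝ) * H ≤ (b : ℝ) ^ k := by exact_mod_cast hCH
    gcongr
  have hxS : q * (b : ℝ) ^ k - q * δ * (b : ℝ) ^ k ≤ e * S.card := by
    have := mul_le_mul_of_nonneg_left hCS hq
    rw [heq]
    linarith
  set R := Finset.range (⌊q * (b : ℝ) ^ k⌋₊ + 1) with hR
  set I := (Finset.range e ×ˢ S).image fun p : ℕ × ℕ => N + (p.1 * H + p.2) with hI
  set f : (Fin k → Fin b) → ℕ := fun w => (R.filter fun i => window k d i = w).card with hf
  set g : (Fin k → Fin b) → ℕ := fun w => (I.filter fun i => window k d i = w).card with hg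
  have h0 : ((R \ I).card + (I \ R).card : ℕ) ≤ 2 * N + 1 + q * δ * (b : ℝ) ^ k :=
    IsConcat.card_symmDiff_le hk hS hx hxS
  have h0' : (Finset.univ.filter fun w => f w ≠ g w).card ≤ (R \ I).card + (I \ R).card :=
    card_filter_card_ne_le (window k d) R I
  have h1 := (abs_card_fiber_sub_le f g j).trans ((Nat.cast_le.2 h0').trans h0)
  have h2 := hd.abs_card_filter_sub_le hS hk hinj he j
  rw [← hI] at h2
  set X := (Finset.univ.filter fun c => ((Finset.range e).filter fun i => A i = c).card = j).card
  have hX : (X : ℝ) / C ≤ 1 := by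
    rw [div_le_one hC0]
    have : X ≤ Fintype.card (Fin C) := Finset.card_le_univ _
    rw [Fintype.card_fin] at this
    exact_mod_cast this
  have hX0 : 0 ≤ (X : ℝ) / C := by positivity
  have h3 : |(S.card : ℝ) * X - X / C * (b : ℝ) ^ k| ≤ (b : ℝ) ^ k - C * S.card := by
    have e1 : (S.card : ℝ) * X - X / C * (b : ℝ) ^ k = -(X / C * ((b : ℝ) ^ k - C * S.card)) := by
      field_simp
      ring
    have e2 := (abs_nonneg _).trans h2
    rw [e1, abs_neg, abs_mul, abs_of_nonneg hX0, abs_of_nonneg e2]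
    exact mul_le_of_le_one_left e2 hX
  have h4 : seqZ d q j k - X / C = (((Finset.univ.filter fun w => f w = j).card : ℝ) - X / C * (b : ℝ) ^ k) / (b : ℝ) ^ k := by
    simp only [seqZ, occ_floor_eq_card d hq]
    rw [sub_div, mul_div_cancel_right₀ _ hb0.ne']
  -- The term `q * δ` and the prefix term come from changing the set of positions; one further `δ`
  -- pays for words in no block, another for replacing `S.card` by `b ^ k / C`.
  have h5 : (2 * N + 1) / (b : ℝ) ^ k + (q + 2) * δ =
      (2 * N + 1 + (q + 2) * δ * (b : ℝ) ^ k) / (b : ℝ) ^ k := by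
    field_simp
  rw [h4, h5, abs_div, abs_of_pos hb0]
  gcongr
  rw [abs_le] at h1 h2 h3 ⊢
  constructor <;> linarith

/-- Few words of length `k + 1` occur in a concatenation of few words of small total length. -/
theorem IsConcat.le_seqZ_zero [NeZero b] (hd : IsConcat d N H E V A) {q : ℝ} (hq : 0 ≤ q)
    (hE : q * (b : ℝ) ^ (k + 1) + (k + 1) ≤ N + E * H) (hCH : C * H ≤ b ^ k) :
    1 - 1 / b - (N + E * k) / (b : ℝ) ^ (k + 1) ≤ seqZ d q 0 (k + 1) := by
  have hb0 : (0 : ℝ) < b := by exact_mod_cast NeZero.pos b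
  set R := Finset.range (⌊q * (b : ℝ) ^ (k + 1)⌋₊ + 1) with hR
  have hR' : ∀ i ∈ R, i + (k + 1) ≤ N + E * H := by
    intro i hi
    rw [hR, Finset.mem_range] at hi
    have h1 : (⌊q * (b : ℝ) ^ (k + 1)⌋₊ : ℝ) ≤ _ := Nat.floor_le (by positivity)
    have h2 : ⌊q * (b : ℝ) ^ (k + 1)⌋₊ + (k + 1) ≤ N + E * H := by
      have : ((⌊q * (b : ℝ) ^ (k + 1)⌋₊ + (k + 1) : ℕ) : ℝ) ≤ (N + E * H : ℕ) := by
        push_cast; linarith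
      exact_mod_cast this
    omega
  have himg : (R.image (window (k + 1) d)).card ≤ N + b ^ k + E * k := by
    -- A window starts in the prefix, lies inside one block, or starts among the last `k` positions
    -- of a block.
    have hsub : R.image (window (k + 1) d) ⊆ ((Finset.range N).image (window (k + 1) d) ∪
        ((Finset.univ : Finset (Fin C)) ×ˢ Finset.range H).image
          (fun p => window (k + 1) (V p.1) p.2)) ∪
        (Finset.range E ×ˢ Finset.range k).image
          (fun p => window (k + 1) d (N + (p.1 * H + (H - k + p.2)))) := by
      intro w hw
      obtain ⟨i, hi, rfl⟩ := Finset.mem_image.1 hw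
      have hi' := hR' i hi
      rw [Finset.mem_union, Finset.mem_union]
      by_cases hiN : i < N
      · exact Or.inl (Or.inl (Finset.mem_image_of_mem _ (Finset.mem_range.2 hiN)))
      obtain ⟨i, rfl⟩ := Nat.exists_eq_add_of_le (not_lt.1 hiN)
      have hH : 0 < H := Nat.pos_of_ne_zero fun h => by subst h; omega
      have ha : i / H < E := (Nat.div_lt_iff_lt_mul hH).2 (by omega)
      have hdm := Nat.div_add_mod' i H
      have hr := Nat.mod_lt i hH
      by_cases hrk : i % H + (k + 1) ≤ H
      · refine Or.inl (Or.inr (Finset.mem_image.2 ⟨(A (i / H), i % H), ?_, ?_⟩))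
        · simpa using hr
        · rw [← hd.window_eq ha hrk, hdm]
      · by_cases hHk : k ≤ H
        · refine Or.inr (Finset.mem_image.2 ⟨(i / H, i % H - (H - k)), ?_, ?_⟩)
          · rw [Finset.mem_product, Finset.mem_range, Finset.mem_range]
            exact ⟨ha, by simp only; omega⟩
          · simp only
            rw [show H - k + (i % H - (H - k)) = i % H by omega, hdm]
        -- Here `H < k`, so `H - k` truncates to `0` and every offset in the block counts as a
        -- boundary position.
        · refine Or.inr (Finset.mem_image.2 ⟨(i / H, i % H), ?_, ?_⟩)
          · rw [Finset.mem_product, Finset.mem_range, Finset.mem_range]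
            exact ⟨ha, by simp only; omega⟩
          · simp only
            rw [show H - k + i % H = i % H by omega, hdm]
    refine (Finset.card_le_card hsub).trans ((Finset.card_union_le _ _).trans
      (add_le_add ((Finset.card_union_le _ _).trans (add_le_add ?_ ?_)) ?_))
    · exact Finset.card_image_le.trans (by simp)
    · exact Finset.card_image_le.trans (by simpa using hCH)
    · exact Finset.card_image_le.trans (by simp)
  have hcompl : (Finset.univ.filter fun w : Fin (k + 1) → Fin b =>
      (R.filter fun i => window (k + 1) d i = w).card = 0) = (R.image (window (k + 1) d))ᶜ := by
    ext w
    simp [Finset.filter_eq_empty_iff]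
  have hsum := Finset.card_compl_add_card (R.image (window (k + 1) d))
  simp only [Fintype.card_pi, Fintype.card_fin, Finset.prod_const, Finset.card_univ] at hsum
  rw [seqZ]
  simp only [occ_floor_eq_card d hq]
  rw [hcompl, le_div_iff₀ (by positivity)]
  have h1 : ((b ^ (k + 1) : ℕ) : ℝ) ≤
      ((R.image (window (k + 1) d))ᶜ.card + (N + b ^ k + E * k) : ℕ) := by
    exact_mod_cast (by omega)
  push_cast at h1
  have h2 : (1 - 1 / b - (N + E * k) / (b : ℝ) ^ (k + 1)) * (b : ℝ) ^ (k + 1) =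
      (b : ℝ) ^ (k + 1) - (b : ℝ) ^ k - (N + E * k) := by
    field_simp
    ring
  linarith

end

/-! ### One stage: extending a prefix. -/

section

variable {b C k l N H E : ℕ} {d : ℕ → Fin b} {V : Fin C → ℕ → Fin b} {A : ℕ → Fin C}

/-- Discrepancies of whole segments add up, with a loss of at most `l` per segment for windows that
leave it. -/
theorem IsConcat.abs_disc_mul_le {g L : ℕ} (hd : IsConcat d N (g * L) E V A) (w : Fin l → Fin b)
    {B : ℝ} (hV : ∀ c, ∀ q < g, |disc w (V c) (q * L) L| ≤ B) {x : ℕ} (hx : x ≤ E * g) :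
    |disc w d N (x * L)| ≤ x * (B + l) := by
  induction x with
  | zero => simp [disc]
  | succ x ih =>
    have hg : 0 < g := Nat.pos_of_ne_zero fun h => by subst h; omega
    have ha : x / g < E := (Nat.div_lt_iff_lt_mul hg).2 (by omega)
    have hq : x % g < g := Nat.mod_lt _ hg
    have h1 : ∀ r < L, d (N + x * L + r) = V (A (x / g)) (x % g * L + r) := by
      intro r hr
      have h2 : (x % g + 1) * L ≤ g * L := Nat.mul_le_mul_right _ hq
      rw [← hd _ ha _ (by linarith)]
      congr 1
      conv_lhs => rw [← Nat.div_add_mod' x g]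
      ring
    have h3 := abs_disc_sub_disc_le w h1
    have h4 := hV (A (x / g)) _ hq
    have h5 := ih (by omega)
    rw [add_mul x 1 L, one_mul, disc_add]
    push_cast
    rw [abs_le] at *
    constructor <;> linarith

theorem IsConcat.abs_disc_le {g L : ℕ} (hL : 0 < L) (hd : IsConcat d N (g * L) E V A)
    (w : Fin l → Fin b) {B : ℝ} (hB : 0 ≤ B) (hV : ∀ c, ∀ q < g, |disc w (V c) (q * L) L| ≤ B)
    {p : ℕ} (hp : p ≤ E * (g * L)) : |disc w d N p| ≤ p / L * (B + l) + L := by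
  have hdm := Nat.div_add_mod' p L
  have hx : p / L ≤ E * g := Nat.div_le_of_le_mul (by linarith)
  have h1 := hd.abs_disc_mul_le w hV hx
  have h2 := PoissonGeneric.abs_disc_le w d (N + p / L * L) (p % L)
  have h3 : ((p % L : ℕ) : ℝ) ≤ L := by exact_mod_cast (Nat.mod_lt p hL).le
  have h4 : ((p / L : ℕ) : ℝ) * (B + l) ≤ p / L * (B + l) := by
    gcongr
    exact Nat.cast_div_le
  have h5 := disc_add w d N (p / L * L) (p % L)
  rw [hdm] at h5
  rw [h5]
  exact (abs_add_le _ _).trans (by linarith)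

theorem exists_isConcat [NeZero b] (d : ℕ → Fin b) (N : ℕ) (V : Fin C → ℕ → Fin b)
    (A : ℕ → Fin C) (E : ℕ) :
    ∃ d' : ℕ → Fin b, (∀ i < N, d' i = d i) ∧ IsConcat d' N H E V A := by
  refine ⟨fun i => if i < N then d i else V (A ((i - N) / H)) ((i - N) % H),
    fun i hi => if_pos hi, fun a _ r hr => ?_⟩
  have hH : 0 < H := by omega
  simp only [if_neg (show ¬ N + (a * H + r) < N by omega), Nat.add_sub_cancel_left]
  rw [Nat.mul_comm a H, Nat.mul_add_div hH, Nat.mul_add_mod, Nat.div_eq_of_lt hr,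
    Nat.mod_eq_of_lt hr, add_zero]

theorem abs_disc_extension_le {d d' : ℕ → Fin b} (h : ∀ i < N, d' i = d i) (w : Fin l → Fin b)
    (p : ℕ) : |disc w d' 0 (N + p)| ≤ |disc w d 0 N| + l + |disc w d' N p| := by
  have h1 := abs_disc_sub_disc_le w (d := d') (c := d) (a := 0) (a' := 0) (n := N)
    fun r hr => by simpa using h r hr
  have h2 := abs_add_le (disc w d' 0 N) (disc w d' N p)
  have h3 := abs_add_le (disc w d' 0 N - disc w d 0 N) (disc w d 0 N)
  rw [sub_add_cancel] at h3
  rw [disc_add, zero_add]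
  linarith

/-- Any finite sequence, if `k` is about the fourth root of its length, can be extended so that
frequencies of short words stay under control, while words of length `k` are nearly Poisson
distributed and words of length `k + 1` are not. -/
theorem eventually_exists_extension [NeZero b] (hb : 2 ≤ b) (n : ℕ) {ε : ℝ} (hε : 0 < ε)
    (Q : Finset ℚ) (hQ : ∀ q ∈ Q, 0 < q) :
    ∀ᶠ k : ℕ in atTop, ∀ (d : ℕ → Fin b) (N : ℕ), k ^ 4 ≤ N → N ≤ (k + 1) ^ 4 →
      ∃ (d' : ℕ → Fin b) (N' : ℕ), (∀ i < N, d' i = d i) ∧ N < N' ∧ (N : ℝ) ≤ ε * N' ∧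
        (∀ l ≤ n, ∀ (w : Fin l → Fin b) (p : ℕ), N ≤ p → p ≤ N' →
          |disc w d' 0 p| ≤ |disc w d 0 N| + ε * p) ∧
        ∀ x : ℕ → Fin b, (∀ i < N', x i = d' i) →
          (∀ q ∈ Q, ∀ j ≤ n, |seqZ x q j k - poissonWeight q j| < ε) ∧
          1 - 1 / b - ε ≤ seqZ x 2 0 (k + 1) := by
  -- The appended part has length at least `T * b ^ k / 2`, so `6 * b ≤ T` makes it reach past `2 *
  -- b ^ (k + 1) + k + 1`. The second condition gives `q * C ≤ E` and makes the total Poisson error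
  -- `(q + 4) * δ` smaller than `ε`.
  obtain ⟨T, hT6, hTQ⟩ : ∃ T : ℕ, 6 * b ≤ T ∧ ∀ q ∈ Q, 2 * ((q : ℝ) + 4) ≤ T := by
    have : ∀ᶠ T : ℕ in atTop, ∀ q ∈ Q, 2 * ((q : ℝ) + 4) ≤ T := by
      rw [Finset.eventually_all]
      exact fun q _ => tendsto_natCast_atTop_atTop.eventually_ge_atTop _
    obtain ⟨T, h1, h2⟩ := ((eventually_ge_atTop (6 * b)).and this).exists
    exact ⟨T, h1, h2⟩
  have hT0 : (12 : ℝ) ≤ T := by exact_mod_cast (by omega : 12 ≤ T)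
  set δ : ℝ := min ε 1 / T with hδ
  have hδ0 : 0 < δ := by positivity
  have hδT : δ * T ≤ ε := by
    rw [hδ, div_mul_cancel₀ _ (by positivity)]; exact min_le_left _ _
  have hδε : 12 * δ ≤ ε := by nlinarith
  have hδ1 : δ ≤ 1 / 2 := by
    have : δ * T ≤ 1 := by
      rw [hδ, div_mul_cancel₀ _ (by positivity)]; exact min_le_right _ _
    nlinarith
  obtain ⟨C, hC, A, hA⟩ := exists_poisson_occupancy Q hQ n hδ0
  set E := C * T with hE
  have hkn : ∀ᶠ k : ℕ in atTop, n / δ ≤ (k : ℝ) :=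
    tendsto_natCast_atTop_atTop.eventually_ge_atTop _
  have hkδ : ∀ᶠ k : ℕ in atTop, 1 / δ ≤ (k : ℝ) :=
    tendsto_natCast_atTop_atTop.eventually_ge_atTop _
  -- Since `N ≤ (k + 1) ^ 4 ≤ 16 * k ^ 4`, the constant `2 * 16 + 1 + E` bounds both `2 * N + 1` and
  -- `N + E * k` by `δ * b ^ k`.
  filter_upwards [eventually_exists_supply hb hC n hδ0, eventually_ge_atTop 1, hkn, hkδ,
    eventually_mul_pow_le hb 4 (2 * 16 + 1 + E) hδ0] with k hk hk1 hkn hkδ hkN d N hN1 hN2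
  obtain ⟨g, V, S, hCH, hS, hCS, hinj, hdisc⟩ := hk
  have hk1' : (1 : ℝ) ≤ k := by exact_mod_cast hk1
  have hb0 : (0 : ℝ) < b := by exact_mod_cast NeZero.pos b
  have hB0 : (0 : ℝ) < (b : ℝ) ^ k := by positivity
  have hC0 : (0 : ℝ) < C := by exact_mod_cast hC
  set L := k ^ 2 with hL
  have hL0 : 0 < L := by positivity
  set H := g * L with hHdef
  have hSne : S.Nonempty := by
    rw [← Finset.card_pos]
    by_contra h
    rw [Nat.pos_iff_ne_zero, not_not] at h
    rw [h, Nat.cast_zero, mul_zero] at hCS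
    nlinarith
  have hH : 0 < H := by have := hS _ hSne.choose_spec; omega
  have hSH : S.card ≤ H := by
    have : S ⊆ Finset.range H := fun r hr => Finset.mem_range.2 (by have := hS r hr; omega)
    simpa using Finset.card_le_card this
  have hNr : (N : ℝ) ≤ 16 * (k : ℝ) ^ 4 := by
    have h1 : (N : ℝ) ≤ ((k : ℝ) + 1) ^ 4 := by exact_mod_cast hN2
    refine h1.trans ?_
    calc ((k : ℝ) + 1) ^ 4 ≤ (2 * k) ^ 4 := by gcongr; linarith
      _ = _ := by ring
  have hk4 : (1 : ℝ) ≤ (k : ℝ) ^ 4 := one_le_pow₀ hk1'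
  have hkk4 : (k : ℝ) ≤ (k : ℝ) ^ 4 := le_self_pow₀ hk1' (by norm_num)
  have hEr : (0 : ℝ) ≤ E := by positivity
  have hkN1 : 2 * (N : ℝ) + 1 ≤ δ * (b : ℝ) ^ k := by
    have : 0 ≤ E * (k : ℝ) ^ 4 := by positivity
    linarith
  have hkN2 : (N : ℝ) + E * k ≤ δ * (b : ℝ) ^ k := by
    have : E * (k : ℝ) ≤ E * (k : ℝ) ^ 4 := by gcongr
    linarith
  have hEH : (T : ℝ) * (b : ℝ) ^ k / 2 ≤ E * H := by
    have h1 : (S.card : ℝ) ≤ H := by exact_mod_cast hSH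
    have h2 : (1 / 2) * (b : ℝ) ^ k ≤ C * H := by
      calc (1 / 2) * (b : ℝ) ^ k ≤ (1 - δ) * (b : ℝ) ^ k := by gcongr; linarith
        _ ≤ C * S.card := hCS
        _ ≤ C * H := by gcongr
    rw [hE]
    push_cast
    nlinarith
  have hbigE : (b : ℝ) ^ k ≤ E * H := by nlinarith
  obtain ⟨d', hd', hconc⟩ := exists_isConcat (H := H) d N V A E
  refine ⟨d', N + E * H, hd', ?_, ?_, ?_, ?_⟩
  · have : 0 < E := Nat.mul_pos hC (by omega)
    have := Nat.mul_pos this hH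
    omega
  · push_cast
    have : δ * (b : ℝ) ^ k ≤ ε * (E * H) := by
      apply mul_le_mul _ hbigE hB0.le hε.le
      linarith
    have h2 : 0 ≤ ε * N := by positivity
    have h3 : (0 : ℝ) ≤ N := by positivity
    linarith
  · intro l hl w p hp1 hp2
    obtain ⟨p, rfl⟩ := Nat.exists_eq_add_of_le hp1
    have h1 := abs_disc_extension_le hd' w p
    have hLr : (L : ℝ) = (k : ℝ) ^ 2 := by rw [hL]; push_cast; rfl
    have h2 := hconc.abs_disc_le hL0 w (B := δ * L) (by positivity)
      (fun c q hq => by rw [hLr]; exact hdisc c q hq l hl w) (p := p)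
      (Nat.le_of_add_le_add_left hp2)
    have hNk : (k : ℝ) ^ 4 ≤ N := by exact_mod_cast hN1
    have hlr : (l : ℝ) ≤ δ * k := by
      rw [div_le_iff₀ hδ0] at hkn
      have : (l : ℝ) ≤ n := by exact_mod_cast hl
      linarith
    have hkL : (k : ℝ) ≤ L := by rw [hLr]; exact le_self_pow₀ hk1' (by norm_num)
    have hL' : (0 : ℝ) < L := by exact_mod_cast hL0
    have h3 : (p : ℝ) / L * (δ * L + l) ≤ 2 * δ * p := by
      calc (p : ℝ) / L * (δ * L + l) ≤ p / L * (δ * L + δ * L) := by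
            gcongr
            exact hlr.trans (by gcongr)
        _ = 2 * δ * p := by field_simp; ring
    -- The lower bound `k ^ 4 ≤ N` makes one incomplete segment negligible against the prefix.
    have h4 : (L : ℝ) ≤ δ * N := by
      rw [div_le_iff₀ hδ0] at hkδ
      calc (L : ℝ) = 1 * (k : ℝ) ^ 2 := by rw [hLr, one_mul]
        _ ≤ (k * δ) * (k : ℝ) ^ 2 := by gcongr
        _ = δ * (k : ℝ) ^ 3 := by ring
        _ ≤ δ * (k : ℝ) ^ 4 := by gcongr; norm_num
        _ ≤ δ * N := by gcongr
    have h5 : (l : ℝ) ≤ δ * N := hlr.trans (mul_le_mul_of_nonneg_left (by linarith) hδ0.le)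
    have h6 : 12 * δ * (N + p) ≤ ε * (N + p) := by gcongr
    have h7 : 0 ≤ δ * (p : ℝ) := by positivity
    have h8 : 0 ≤ δ * (N : ℝ) := by positivity
    push_cast
    linarith
  · intro x hx
    have hxc : IsConcat x N H E V A := by
      intro a ha r hr
      rw [← hconc a ha r hr]
      apply hx
      have : (a + 1) * H ≤ E * H := Nat.mul_le_mul_right _ ha
      linarith
    refine ⟨fun q hq j hj => ?_, ?_⟩
    · obtain ⟨e, he, hej⟩ := hA q hq
      have hq0 : (0 : ℝ) < q := by exact_mod_cast hQ q hq
      have heE : e ≤ E := by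
        have : (e : ℝ) ≤ E := by
          rw [he, hE, Nat.cast_mul, mul_comm]
          gcongr
          linarith [hTQ q hq]
        exact_mod_cast this
      have h1 := hxc.abs_seqZ_sub_le hS hk1 hC hinj hCH hCS heE hq0.le he j
      have h2 := hej j hj
      have h3 : (2 * N + 1) / (b : ℝ) ^ k ≤ δ := (div_le_iff₀ hB0).2 hkN1
      have h4 : δ * (2 * ((q : ℝ) + 4)) ≤ δ * T := by gcongr; exact hTQ q hq
      have h5 : 0 < δ * q := by positivity
      rw [abs_lt] at h2 ⊢
      rw [abs_le] at h1
      constructor <;> linarith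
    · have h0 : (6 * b : ℝ) ≤ T := by exact_mod_cast hT6
      have h1 : (2 : ℝ) * (b : ℝ) ^ (k + 1) + (k + 1) ≤ N + E * H := by
        have e1 : 6 * b * (b : ℝ) ^ k ≤ T * (b : ℝ) ^ k := by gcongr
        have e2 : (k : ℝ) + 1 ≤ (b : ℝ) ^ k := by
          have : k < b ^ k := Nat.lt_pow_self (by omega)
          exact_mod_cast this
        have e3 : (b : ℝ) ^ k ≤ b * (b : ℝ) ^ k :=
          le_mul_of_one_le_left hB0.le (by exact_mod_cast NeZero.one_le)
        have e4 : (0 : ℝ) ≤ N := by positivity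
        rw [pow_succ]
        linarith
      have h2 := hxc.le_seqZ_zero (k := k) (by norm_num) h1 hCH
      have h3 : ((N : ℝ) + E * k) / (b : ℝ) ^ (k + 1) ≤ δ := by
        rw [div_le_iff₀ (by positivity)]
        refine hkN2.trans ?_
        gcongr
        · exact_mod_cast NeZero.one_le
        · omega
      linarith

end

/-! ### Iterating the stages and passing to the limit. -/

section

variable {b : ℕ}

/-- Finite sets of positive rationals, increasing with `n`, whose union is everything. -/
def posRat (n : ℕ) : Finset ℚ :=
  ((Finset.range n).image (Denumerable.eqv ℚ).symm).filter (0 < ·)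

theorem mem_posRat {q : ℚ} (hq : 0 < q) {n : ℕ} (hn : Denumerable.eqv ℚ q < n) : q ∈ posRat n :=
  Finset.mem_filter.2 ⟨Finset.mem_image.2
    ⟨_, Finset.mem_range.2 hn, Equiv.symm_apply_apply _ q⟩, hq⟩

/-- `t` is an extension of the finite sequence `s` in which the frequencies of words of length at
most `n` are under control, and which settles the distribution of the words of length `k` and
`k + 1`, up to an error of `1 / (n + 1)`. -/
structure Extends (s t : (ℕ → Fin b) × ℕ) (n k : ℕ) : Prop where
  eq : ∀ i < s.2, t.1 i = s.1 i
  lt : s.2 < t.2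
  le : (s.2 : ℝ) ≤ 1 / (n + 1) * t.2
  disc : ∀ l ≤ n, ∀ (w : Fin l → Fin b) (p : ℕ), s.2 ≤ p → p ≤ t.2 →
    |disc w t.1 0 p| ≤ |disc w s.1 0 s.2| + 1 / (n + 1) * p
  poisson : ∀ x : ℕ → Fin b, (∀ i < t.2, x i = t.1 i) → ∀ q ∈ posRat n, ∀ j ≤ n,
    |seqZ x q j k - poissonWeight q j| < 1 / (n + 1)
  not_poisson : ∀ x : ℕ → Fin b, (∀ i < t.2, x i = t.1 i) →
    1 - 1 / b - 1 / (n + 1) ≤ seqZ x 2 0 (k + 1)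

theorem exists_pow_four_le (N : ℕ) : ∃ k, k ^ 4 ≤ N ∧ N < (k + 1) ^ 4 := by
  refine ⟨N.sqrt.sqrt, ?_, ?_⟩
  · calc N.sqrt.sqrt ^ 4 = (N.sqrt.sqrt ^ 2) ^ 2 := by ring
      _ ≤ N.sqrt ^ 2 := Nat.pow_le_pow_left (Nat.sqrt_le' _) 2
      _ ≤ N := Nat.sqrt_le' _
  · calc N < (N.sqrt + 1) ^ 2 := Nat.lt_succ_sqrt' _
      _ ≤ ((N.sqrt.sqrt + 1) ^ 2) ^ 2 := Nat.pow_le_pow_left (Nat.lt_succ_sqrt' _) 2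
      _ = (N.sqrt.sqrt + 1) ^ 4 := by ring

theorem exists_extends_chain [NeZero b] (hb : 2 ≤ b) :
    ∃ (s : ℕ → (ℕ → Fin b) × ℕ) (n k : ℕ → ℕ), Tendsto n atTop atTop ∧ Tendsto k atTop atTop ∧
      ∀ p, Extends (s p) (s (p + 1)) (n p) (k p) := by
  have hstep : ∀ n : ℕ, ∃ K, ∀ k ≥ K, ∀ s : (ℕ → Fin b) × ℕ, k ^ 4 ≤ s.2 → s.2 ≤ (k + 1) ^ 4 →
      ∃ t, Extends s t n k := by
    intro n
    obtain ⟨K, hK⟩ := eventually_atTop.1 (eventually_exists_extension hb n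
      (show (0 : ℝ) < 1 / (n + 1) by positivity) (posRat n) fun q hq => (Finset.mem_filter.1 hq).2)
    refine ⟨K, fun k hk s h1 h2 => ?_⟩
    obtain ⟨d', N', e1, e2, e3, e4, e5⟩ := hK k hk s.1 s.2 h1 h2
    exact ⟨(d', N'), e1, e2, e3, e4, fun x hx => (e5 x hx).1, fun x hx => (e5 x hx).2⟩
  choose K hK using hstep
  choose ρ hρ using exists_pow_four_le
  have hρle : ∀ m N, m ^ 4 ≤ N → m ≤ ρ N := by
    intro m N h
    have := lt_of_pow_lt_pow_left₀ 4 (Nat.zero_le _) (h.trans_lt (hρ N).2)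
    omega
  -- Diagonal choice: the precision is the largest `n ≤ k` whose threshold `K n` has been passed.
  let lev : ℕ → ℕ := fun k => Nat.findGreatest (fun n => K n ≤ k) k
  have hlev : ∀ k, K 0 ≤ k → K (lev k) ≤ k := fun k hk =>
    Nat.findGreatest_spec (P := fun n => K n ≤ k) (Nat.zero_le k) hk
  have hlevt : Tendsto lev atTop atTop := by
    refine tendsto_atTop.2 fun n => ?_
    filter_upwards [eventually_ge_atTop n, eventually_ge_atTop (K n)] with k h1 h2
    exact Nat.le_findGreatest h1 h2
  have hρt : Tendsto ρ atTop atTop := by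
    refine tendsto_atTop.2 fun m => ?_
    filter_upwards [eventually_ge_atTop (m ^ 4)] with N hN
    exact hρle m N hN
  have hF : ∀ s : (ℕ → Fin b) × ℕ, ∃ t, K 0 ≤ ρ s.2 → Extends s t (lev (ρ s.2)) (ρ s.2) := by
    intro s
    by_cases h : K 0 ≤ ρ s.2
    · obtain ⟨t, ht⟩ := hK _ _ (hlev _ h) s (hρ s.2).1 (hρ s.2).2.le
      exact ⟨t, fun _ => ht⟩
    · exact ⟨s, fun h' => absurd h' h⟩
  choose F hF using hF
  -- The initial length `K 0 ^ 4` puts the first stage above the threshold for precision `0`, and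
  -- lengths only grow.
  let s : ℕ → (ℕ → Fin b) × ℕ := fun p => F^[p] (fun _ => 0, K 0 ^ 4)
  have hs : ∀ p, s (p + 1) = F (s p) := fun p => Function.iterate_succ_apply' _ _ _
  have hbase : ∀ p, K 0 ^ 4 ≤ (s p).2 := by
    intro p
    induction p with
    | zero => exact le_rfl
    | succ p ih => rw [hs]; exact ih.trans (hF _ (hρle _ _ ih)).lt.le
  have hext : ∀ p, Extends (s p) (s (p + 1)) (lev (ρ (s p).2)) (ρ (s p).2) := fun p => by
    rw [hs]; exact hF _ (hρle _ _ (hbase p))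
  have hmono : StrictMono fun p => (s p).2 := strictMono_nat_of_lt_succ fun p => (hext p).lt
  exact ⟨s, fun p => lev (ρ (s p).2), fun p => ρ (s p).2,
    hlevt.comp (hρt.comp hmono.tendsto_atTop), hρt.comp hmono.tendsto_atTop, hext⟩

theorem exists_limit_sequence {s : ℕ → (ℕ → Fin b) × ℕ} {n k : ℕ → ℕ}
    (h : ∀ p, Extends (s p) (s (p + 1)) (n p) (k p)) :
    ∃ x : ℕ → Fin b, ∀ p, ∀ i < (s p).2, x i = (s p).1 i := by
  have hmono : StrictMono fun p => (s p).2 := strictMono_nat_of_lt_succ fun p => (h p).lt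
  have hagree : ∀ p r, ∀ i < (s p).2, (s (p + r)).1 i = (s p).1 i := by
    intro p r
    induction r with
    | zero => exact fun _ _ => rfl
    | succ r ih =>
      intro i hi
      rw [← ih i hi]
      exact (h (p + r)).eq i (hi.trans_le (hmono.monotone (Nat.le_add_right p r)))
  refine ⟨fun i => (s (i + 1)).1 i, fun p i hi => ?_⟩
  have hi' : i < (s (i + 1)).2 := hmono.le_apply (x := i + 1)
  rcases le_total p (i + 1) with hp | hp
  · obtain ⟨r, hr⟩ := Nat.exists_eq_add_of_le hp
    simp only [hr]
    exact hagree p r i hi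
  · obtain ⟨r, rfl⟩ := Nat.exists_eq_add_of_le hp
    exact (hagree (i + 1) r i hi').symm

theorem tendsto_disc_div {s : ℕ → (ℕ → Fin b) × ℕ} {n k : ℕ → ℕ} (hn : Tendsto n atTop atTop)
    (h : ∀ p, Extends (s p) (s (p + 1)) (n p) (k p)) {x : ℕ → Fin b}
    (hx : ∀ p, ∀ i < (s p).2, x i = (s p).1 i) {l : ℕ} (w : Fin l → Fin b) :
    Tendsto (fun m : ℕ => disc w x 0 m / m) atTop (𝓝 0) := by
  have hmono : StrictMono fun p => (s p).2 := strictMono_nat_of_lt_succ fun p => (h p).lt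
  rw [Metric.tendsto_atTop]
  intro ε hε
  set η := ε / 5 with hη
  have hη0 : 0 < η := by positivity
  have h1 : Tendsto (fun p => 1 / ((n p : ℝ) + 1)) atTop (𝓝 0) :=
    tendsto_one_div_add_atTop_nhds_zero_nat.comp hn
  obtain ⟨P, hP⟩ := eventually_atTop.1 ((h1.eventually_le_const hη0).and
    (hn.eventually_ge_atTop l))
  obtain ⟨M, hM⟩ := exists_nat_ge (l / η)
  refine ⟨max (max (s (P + 1)).2 M) 1, fun m hm => ?_⟩
  have hm1 : (s (P + 1)).2 ≤ m := (le_max_left _ _).trans ((le_max_left _ _).trans hm)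
  have hm2 : (M : ℝ) ≤ m := by
    exact_mod_cast (le_max_right _ _).trans ((le_max_left _ _).trans hm)
  have hm0 : 0 < m := (le_max_right _ _).trans hm
  have hex : ∃ p, m < (s p).2 := ⟨m + 1, hmono.le_apply (x := m + 1)⟩
  -- Going back two stages makes the trivial bound by the length of `s p` good enough, because that
  -- length is at most `η` times the next one.
  obtain ⟨p, hp1, hp2, hPp⟩ : ∃ p, (s (p + 1)).2 ≤ m ∧ m < (s (p + 2)).2 ∧ P ≤ p := by
    have hspec := Nat.find_spec hex
    have hlt : P + 1 < Nat.find hex := by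
      by_contra hcon
      exact absurd (hspec.trans_le (hmono.monotone (not_lt.1 hcon))) (not_lt.2 hm1)
    obtain ⟨r, hr⟩ := Nat.exists_eq_add_of_lt hlt
    have hmin := Nat.find_min hex (m := P + r + 1) (by omega)
    refine ⟨P + r, not_lt.1 hmin, ?_, Nat.le_add_right _ _⟩
    rw [hr] at hspec
    convert! hspec using 3
    omega
  have e1 := (h (p + 1)).disc l (hP (p + 1) (by omega)).2 w m hp1 hp2.le
  have e2 := (h p).disc l (hP p hPp).2 w (s (p + 1)).2 (h p).lt.le le_rfl
  have e3 := abs_disc_le w (s p).1 0 (s p).2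
  have e4 := (h p).le
  have e5 := abs_disc_sub_disc_le w (d := x) (c := (s (p + 2)).1) (a := 0) (a' := 0) (n := m)
    fun r hr => hx _ _ (by omega)
  have e6 := abs_add_le (disc w x 0 m - disc w (s (p + 2)).1 0 m) (disc w (s (p + 2)).1 0 m)
  rw [sub_add_cancel] at e6
  have hm0' : (0 : ℝ) < m := by exact_mod_cast hm0
  have hp1' : ((s (p + 1)).2 : ℝ) ≤ m := by exact_mod_cast hp1
  have e7 : 1 / ((n p : ℝ) + 1) * (s (p + 1)).2 ≤ η * m :=
    mul_le_mul (hP p hPp).1 hp1' (Nat.cast_nonneg _) hη0.le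
  have e8 : 1 / ((n (p + 1) : ℝ) + 1) * m ≤ η * m :=
    mul_le_mul_of_nonneg_right (hP (p + 1) (by omega)).1 hm0'.le
  have e9 : (l : ℝ) ≤ η * m := by
    rw [div_le_iff₀ hη0] at hM
    nlinarith
  have hηm : 0 < η * m := by positivity
  rw [Real.dist_eq, sub_zero, abs_div, Nat.abs_cast, div_lt_iff₀ hm0',
    show ε = 5 * η by rw [hη]; ring]
  linarith

/-- If all digits from `N` on were `b - 1`, the digit `0` would never occur again and its
discrepancy would decrease linearly with slope `-1 / b`. -/
theorem exists_digit_lt_of_tendsto_disc [NeZero b] (hb : 2 ≤ b) {x : ℕ → Fin b}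
    (h : Tendsto (fun m : ℕ => disc (fun _ : Fin 1 => (0 : Fin b)) x 0 m / m) atTop (𝓝 0)) (N : ℕ) :
    ∃ i, (x (N + i) : ℕ) + 1 < b := by
  by_contra! hcon
  set w : Fin 1 → Fin b := fun _ => 0
  have hb0 : (0 : ℝ) < b := by exact_mod_cast NeZero.pos b
  have h1 : ∀ m, disc w x N m = -(m / b) := by
    intro m
    have : ∀ i, dev w x (N + i) = -(1 / b) := by
      intro i
      have hne : ¬ window 1 x (N + i) = w := by
        intro h
        have h2 := congrFun h 0
        simp only [window, w, Fin.val_zero, add_zero] at h2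
        have := hcon i
        rw [h2, Fin.val_zero] at this
        omega
      simp [dev, hne]
    simp only [disc, this]
    simp
    ring
  have h2 : Tendsto (fun m : ℕ => ((N : ℝ) + 1) / m) atTop (𝓝 0) :=
    tendsto_const_div_atTop_nhds_zero_nat _
  have hε : (0 : ℝ) < 1 / (4 * b) := by positivity
  obtain ⟨m, ⟨h3, h4⟩, h5⟩ := (((Metric.tendsto_nhds.1 h _ hε).and
    (h2.eventually_le_const hε)).and (eventually_gt_atTop N)).exists
  obtain ⟨r, rfl⟩ := Nat.exists_eq_add_of_lt h5
  have hm : (0 : ℝ) < (N + r + 1 : ℕ) := by positivity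
  rw [Real.dist_eq, sub_zero, abs_div, Nat.abs_cast, div_lt_iff₀ hm] at h3
  rw [div_le_iff₀ hm] at h4
  have h6 := disc_add w x 0 N (r + 1)
  rw [zero_add, h1] at h6
  have h7 := abs_disc_le w x 0 N
  rw [add_assoc] at h3 h4
  rw [h6] at h3
  have h8 : ((r + 1 : ℕ) : ℝ) / b = 4 * (1 / (4 * b) * (r + 1 : ℕ)) := by field_simp
  have h9 : (N : ℝ) / b ≤ N := div_le_self (Nat.cast_nonneg _) (by exact_mod_cast NeZero.one_le)
  rw [abs_lt] at h3
  rw [abs_le] at h7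
  push_cast at *
  have h10 : 1 / (4 * (b : ℝ)) * N = N / b / 4 := by field_simp
  have h11 : (0 : ℝ) ≤ N := Nat.cast_nonneg N
  linarith

theorem poissonWeight_two_zero_lt : poissonWeight 2 0 < 1 / 4 := by
  have h1 : (2 : ℝ) < Real.exp 1 := lt_trans (by norm_num) Real.exp_one_gt_d9
  have h2 : Real.exp 2 = Real.exp 1 * Real.exp 1 := by rw [← Real.exp_add]; norm_num
  have h3 : (4 : ℝ) < Real.exp 2 := by rw [h2]; nlinarith
  simp only [poissonWeight, pow_zero, mul_one, Nat.factorial_zero, Nat.cast_one, div_one]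
  rw [Real.exp_neg, ← one_div]
  exact one_div_lt_one_div_of_lt (by norm_num) h3

end

end PoissonGeneric

theorem mainTheorem5 (b : ℕ) [NeZero b] (hb : 2 ≤ b) :
    ∃ x ∈ Set.Ico (0 : ℝ) 1, PoissonGeneric.IsNormal b x ∧
      PoissonGeneric.IsWeaklyPoissonGeneric b x ∧ ¬ PoissonGeneric.IsPoissonGeneric b x := by
  obtain ⟨s, n, k, hn, hk, hs⟩ := PoissonGeneric.exists_extends_chain (b := b) hb
  obtain ⟨x, hx⟩ := PoissonGeneric.exists_limit_sequence hs
  have hdisc : ∀ (l : ℕ) (w : Fin l → Fin b),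
      Tendsto (fun m : ℕ => PoissonGeneric.disc w x 0 m / m) atTop (𝓝 0) :=
    fun l w => PoissonGeneric.tendsto_disc_div hn hs hx w
  have hlast := PoissonGeneric.exists_digit_lt_of_tendsto_disc hb (hdisc 1 _)
  have hdig := PoissonGeneric.digits_ofDigits x hlast
  have h1 : Tendsto (fun p => 1 / ((n p : ℝ) + 1)) atTop (𝓝 0) :=
    tendsto_one_div_add_atTop_nhds_zero_nat.comp hn
  have hZ : ∀ l j k, PoissonGeneric.Z b (Real.ofDigits x) l j k = PoissonGeneric.seqZ x l j k := by
    intro l j k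
    rw [PoissonGeneric.Z, PoissonGeneric.seqZ, hdig]
  refine ⟨Real.ofDigits x, ⟨Real.ofDigits_nonneg x, ?_⟩, ?_, ?_, ?_⟩
  · obtain ⟨i, hi⟩ := hlast 0
    exact PoissonGeneric.ofDigits_lt_one x _ hi
  · exact PoissonGeneric.isNormal_of_tendsto_disc (by rwa [hdig])
  · intro ε hε q hq j
    refine Set.infinite_of_forall_exists_gt fun a => ?_
    obtain ⟨p, ⟨⟨⟨hp1, hp2⟩, hp3⟩, hp4⟩⟩ := ((((h1.eventually_le_const hε).and
      (hn.eventually_gt_atTop (Denumerable.eqv ℚ q))).and (hn.eventually_ge_atTop j)).and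
        (hk.eventually_gt_atTop a)).exists
    refine ⟨k p, ?_, hp4⟩
    rw [Set.mem_ofPred_eq, hZ]
    exact ((hs p).poisson x (hx (p + 1)) q (PoissonGeneric.mem_posRat hq hp2) j hp3).trans_le hp1
  · intro hcon
    -- Along the lengths `k p + 1` the proportion of absent words is at least `1 - 1 / 2 - 1 / 4 = 1
    -- / 4` for large `p`, while its limit would have to be `exp (-2) < 1 / 4`.
    have h2 := hcon 2 two_pos 0
    simp only [hZ] at h2
    have h3 := h2.comp ((tendsto_add_atTop_nat 1).comp hk)
    obtain ⟨p, hp1, hp2⟩ := ((h3.eventually_lt_const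
      PoissonGeneric.poissonWeight_two_zero_lt).and
        (h1.eventually_le_const (show (0 : ℝ) < 1 / 4 by norm_num))).exists
    have h4 := (hs p).not_poisson x (hx (p + 1))
    have h5 : 1 / (b : ℝ) ≤ 1 / 2 :=
      one_div_le_one_div_of_le two_pos (by exact_mod_cast hb)
    simp only [Function.comp_apply] at hp1
    linarith
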